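/- **Conventions.** Fibration means Grothendieck fibration. 2-functors are strict. For an adjunction $L\dashv R$ with $L\colon\mathcal D\to\mathcal C$ and another one $L'\dashv R'$, the mate of $\zeta\colon L'G\Rightarrow FL$ is $\zeta^\#=R'F\epsilon\circ R'\zeta R\circ\eta'GR\colon GR\Rightarrow R'F$. A wide 2-full sub-2-category has all objects, some of the 1-cells and all 2-cells between these. * $\mathbf{Cmd}$: objects are comonads $(K,\epsilon,\nu)$ on categories; 1-cells $K\to K'$ are lax morphisms $(H,\theta)$, i.e. functors $H$ with $\theta\colon HK\Rightarrow K'H$ such that $\epsilon'H\circ\theta=H\epsilon$ and $\nu'H\circ\theta=K'\theta\circ\theta K\circ H\nu$; 2-cells are natural transformations $\phi\colon H_1\Rightarrow H_2$ with $K'\phi\circ\theta_1=\theta_2\circ\phi K$. A 1-cell is pseudo (strict) if $\theta$ is invertible (an identity). * $\mathbf{Adj}^{\cong}$: objects are adjunctions; 1-cells $(L\dashv R)\to(L'\dashv R')$ are left loose morphisms $(F,G,\zeta)$, with $\zeta\colon L'G\cong FL$ a natural isomorphism; 2-cells are pairs $\phi\colon F_1\Rightarrow F_2$, $\psi\colon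 G_1\Rightarrow G_2$ with $\phi L\circ\zeta_1=\zeta_2\circ L'\psi$. $\mathbf{Adj}$ is the wide 2-full sub-2-category on the 1-cells with $\zeta=\mathrm{id}$. A 1-cell is pseudo (strict) if $\zeta^\#$ is invertible (an identity). * $\mathbf{Fib}$: objects are fibrations; 1-cells are commutative squares whose upper functor preserves cartesian arrows; 2-cells are compatible pairs of natural transformations. * $\mathbf{WCCmd}$: objects are pairs of a fibration $p\colon\mathcal E\to\mathcal B$ and a weakening and contraction comonad on it, i.e. a comonad $(K,\epsilon,\nu)$ on $\mathcal E$ such that the components of $\epsilon$ are cartesian and, for each cartesian arrow $f$, the image under $p$ of the naturality square of $\epsilon$ at $f$ is a pullback; 1-cells are triples $(C,H,\theta)$ with $(C,H)$ a 1-cell of $\mathbf{Fib}$ and $(H,\theta)$ a 1-cell of $\mathbf{Cmd}$; 2-cells are the 2-cells $(\psi,\phi)$ of $\mathbf{Fib}$ such that $\phi$ is a 2-cell of $\mathbf{Cmd}$. $\mathbf{WCCmd}_{\mathrm{ps}}$ and $\mathbf{WCCmd}_{\mathrm{str}}$ are the wide 2-full sub-2-categories on the 1-cells with $(H,\theta)$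 pseudo, respectively strict. * $\mathbf{GCwf}^{\cong}$: objects are generalised categories with families (gcwfs), i.e. fibrations $u\colon\mathcal U\to\mathcal B$ and $\dot u\colon\dot{\mathcal U}\to\mathcal B$ with a morphism of fibrations $\Sigma\colon\dot u\to u$ over $\mathcal B$ and a right adjoint $\Delta$ to the functor $\Sigma$ such that the unit and the counit have cartesian components; 1-cells are loose gcwf morphisms $(C,H,\dot H,\zeta)$, with $(C,H)\colon u\to u'$ and $(C,\dot H)\colon\dot u\to\dot u'$ 1-cells of $\mathbf{Fib}$ and $\zeta\colon\Sigma'\dot H\cong H\Sigma$ a vertical natural isomorphism; 2-cells are triples $(\psi,\phi,\dot\phi)$ such that $(\psi,\phi)$ and $(\psi,\dot\phi)$ are 2-cells of $\mathbf{Fib}$ and $(\phi,\dot\phi)$ is a 2-cell of $\mathbf{Adj}^{\cong}$. $\mathbf{GCwf}$ is the wide 2-full sub-2-category on the gcwf morphisms, i.e. the 1-cells with $\zeta=\mathrm{id}$. The subscripts $\mathrm{ps}$ and $\mathrm{str}$ denote the wide 2-full sub-2-categories on the 1-cells whose underlying 1-cell in $\mathbf{Adj}^{\cong}$ is pseudo,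 respectively strict. A *bireflection* of $\mathbf C$ into $\mathbf D$ consists here of 2-functors $R\colon\mathbf C\to\mathbf D$ and $L\colon\mathbf D\to\mathbf C$ with $LR=\mathrm{Id}$ and a pseudonatural transformation $\boldsymbol\eta\colon\mathrm{Id}\Rightarrow RL$ such that $L\boldsymbol\eta$ and $\boldsymbol\eta R$ are identities and these data form a biadjunction $L\dashv R$ with identity counit and identity triangulators. It is a *2-reflection* if $\boldsymbol\eta$ is strictly 2-natural, and an *adjoint biequivalence* if the components of $\boldsymbol\eta$ are equivalences. It *lifts* another bireflection along 2-functors $U$, $V$ if right adjoints, left adjoints and units commute strictly with $U$ and $V$, and it is a *restriction* of the other one if moreover $U$ and $V$ are inclusions of sub-2-categories. There is a bireflection of $\mathbf{Cmd}$ into $\mathbf{Adj}^{\cong}$: the right adjoint sends a comonad to its Eilenberg–Moore adjunction and $(H,\theta)$ to $(H,\mathrm{Coalg}(H,\theta),\mathrm{id})$, the left adjoint sends $L\dashv R$ to the comonad $LR$ and $(F,G,\zeta)$ to $(F,L'\zeta^\#\circ\zeta^{-1}R)$, and the unit is given by the Eilenberg–Moore comparison functors, with the 2-cell $(\mathrm{id}_F,\hat\zeta)$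 at $(F,G,\zeta)$, where $\hat\zeta$ is the lift of $\zeta$ to coalgebras. It restricts to a 2-reflection of $\mathbf{Cmd}$ into $\mathbf{Adj}$. **Theorem.** 1. The bireflection of $\mathbf{Cmd}$ into $\mathbf{Adj}^{\cong}$ lifts along the forgetful 2-functors $\mathbf{WCCmd}\to\mathbf{Cmd}$ and $\mathbf{GCwf}^{\cong}\to\mathbf{Adj}^{\cong}$ to an adjoint biequivalence between $\mathbf{WCCmd}$ and $\mathbf{GCwf}^{\cong}$ whose counit is the identity; in particular the composite $\mathbf{WCCmd}\to\mathbf{GCwf}^{\cong}\to\mathbf{WCCmd}$ is the identity 2-functor. The two 2-functors commute strictly with the forgetful 2-functors to $\mathbf{Fib}$ (which keep $p$, respectively $u$), and the latter send the unit to the identity. 2. This biequivalence restricts along $\mathbf{GCwf}\hookrightarrow\mathbf{GCwf}^{\cong}$ to a 2-reflection of $\mathbf{WCCmd}$ into $\mathbf{GCwf}$, which lifts the 2-reflection of $\mathbf{Cmd}$ into $\mathbf{Adj}$. 3. The biequivalence restricts to an adjoint biequivalence between $\mathbf{WCCmd}_{\mathrm{ps}}$ and $\mathbf{GCwf}^{\cong}_{\mathrm{ps}}$.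 4. The 2-reflection restricts to 2-reflections of $\mathbf{WCCmd}_{\mathrm{ps}}$ into $\mathbf{GCwf}_{\mathrm{ps}}$ and of $\mathbf{WCCmd}_{\mathrm{str}}$ into $\mathbf{GCwf}_{\mathrm{str}}$. -/

import Mathlib

open CategoryTheory Bicategory

universe v u w₁ v₁ u₁ w₂ v₂ u₂ w₃ v₃ u₃ w₄ v₄ u₄

namespace WCC

/-- A morphism is an identity: its source and target are equal and it is the identity on them.
For instance, for a natural transformation `a : F ⟶ G` this says that `F = G` and that `a` is the
identity of `F`. -/
def IsIdentity {C : Type*} [CategoryStruct C] {X Y : C} (f : X ⟶ Y) : Prop :=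
  ∃ h : X = Y, f = eqToHom h

/-- A category with a comonad on it: the objects of the 2-category of comonads. -/
structure Cmd : Type (max u v + 1) where
  C : Type (max u v)
  [cat : Category.{v} C]
  K : Comonad C

attribute [instance] Cmd.cat

namespace Cmd

/-- A lax morphism of comonads `(H, θ)`: a functor `H` with `θ : H K ⟹ K' H` such that
`ε' H ∘ θ = H ε` and `ν' H ∘ θ = K' θ ∘ θ K ∘ H ν`. -/
structure Hom (X Y : Cmd.{v, u}) where
  H : X.C ⥤ Y.C
  θ : X.K.toFunctor ⋙ H ⟶ H ⋙ Y.K.toFunctor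
  counit : ∀ A, θ.app A ≫ Y.K.ε.app (H.obj A) = H.map (X.K.ε.app A)
  comult : ∀ A, θ.app A ≫ Y.K.δ.app (H.obj A) =
    H.map (X.K.δ.app A) ≫ θ.app (X.K.obj A) ≫ Y.K.map (θ.app A)

/-- A 2-cell `(H₁, θ₁) ⟶ (H₂, θ₂)`: a natural transformation `φ : H₁ ⟹ H₂` with
`K' φ ∘ θ₁ = θ₂ ∘ φ K`. -/
@[ext]
structure Hom₂ {X Y : Cmd.{v, u}} (f g : Hom X Y) where
  φ : f.H ⟶ g.H
  comm : ∀ A, f.θ.app A ≫ Y.K.map (φ.app A) = φ.app (X.K.obj A) ≫ g.θ.app A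

@[simps]
instance (X Y : Cmd.{v, u}) : Category (Hom X Y) where
  Hom := Hom₂
  id f := { φ := 𝟙 f.H, comm := by simp }
  comp a b := { φ := a.φ ≫ b.φ, comm := by intro A; simp [reassoc_of% a.comm, b.comm] }

@[ext]
lemma hom_ext {X Y : Cmd.{v, u}} {f g : Hom X Y} {a b : f ⟶ g} (h : a.φ = b.φ) : a = b :=
  Hom₂.ext h

@[simps, reducible]
def Hom.id (X : Cmd.{v, u}) : Hom X X where
  H := 𝟭 _
  θ := 𝟙 _
  counit := by simp
  comult := by simp

@[simps, reducible]
def Hom.comp {X Y Z : Cmd.{v, u}} (f : Hom X Y) (g : Hom Y Z) : Hom X Z where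
  H := f.H ⋙ g.H
  θ := { app A := g.H.map (f.θ.app A) ≫ g.θ.app (f.H.obj A)
         naturality A B h := by
          have h1 := f.θ.naturality h
          have h2 := g.θ.naturality (f.H.map h)
          dsimp at h1 h2 ⊢
          rw [← g.H.map_comp_assoc, h1, g.H.map_comp_assoc, h2, Category.assoc] }
  counit A := by
    simp only [Category.assoc, Functor.comp_obj]
    rw [g.counit, ← g.H.map_comp, f.counit]; rfl
  comult A := by
    have h2 := g.θ.naturality (f.θ.app A)
    dsimp at h2 ⊢
    simp only [Category.assoc]
    rw [g.comult, ← g.H.map_comp_assoc, f.comult]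
    simp [reassoc_of% h2]

lemma Hom.mk_congr {X Y : Cmd.{v, u}} {H : X.C ⥤ Y.C}
    {θ θ' : X.K.toFunctor ⋙ H ⟶ H ⋙ Y.K.toFunctor} {c d c' d'}
    (h : ∀ A, θ.app A = θ'.app A) : Hom.mk H θ c d = Hom.mk H θ' c' d' := by
  obtain rfl : θ = θ' := by ext A; exact h A
  rfl

lemma Hom.id_comp {X Y : Cmd.{v, u}} (f : Hom X Y) : (Hom.id X).comp f = f :=
  Hom.mk_congr (by intro A; simp)

lemma Hom.comp_id {X Y : Cmd.{v, u}} (f : Hom X Y) : f.comp (Hom.id Y) = f :=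
  Hom.mk_congr (by intro A; simp)

lemma Hom.assoc {X Y Z W : Cmd.{v, u}} (f : Hom X Y) (g : Hom Y Z) (h : Hom Z W) :
    (f.comp g).comp h = f.comp (g.comp h) :=
  Hom.mk_congr (by intro A; simp)

/-- The 2-category of comonads, lax morphisms of comonads and their 2-cells. -/
instance : Bicategory.{max u v, max u v} Cmd.{v, u} where
  Hom := Hom
  id := Hom.id
  comp := Hom.comp
  homCategory X Y := inferInstance
  whiskerLeft {X Y Z} f {g h} a :=
    { φ := Functor.whiskerLeft f.H a.φ
      comm := by
        intro A
        have := a.φ.naturality (f.θ.app A)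
        have := a.comm (f.H.obj A)
        simp_all }
  whiskerRight {X Y Z} f g a h :=
    { φ := Functor.whiskerRight a.φ h.H
      comm := by
        intro A
        have h1 := h.θ.naturality (a.φ.app A)
        have := a.comm A
        dsimp at *
        rw [Category.assoc, ← h1, ← Functor.map_comp_assoc, this]
        simp }
  associator f g h :=
    { hom := { φ := (Functor.associator _ _ _).hom, comm := by intro A; simp }
      inv := { φ := (Functor.associator _ _ _).inv, comm := by intro A; simp }
      hom_inv_id := by ext; simp
      inv_hom_id := by ext; simp }
  leftUnitor f :=
    { hom := { φ := (Functor.leftUnitor _).hom, comm := by intro A; simp }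
      inv := { φ := (Functor.leftUnitor _).inv, comm := by intro A; simp }
      hom_inv_id := by ext; simp
      inv_hom_id := by ext; simp }
  rightUnitor f :=
    { hom := { φ := (Functor.rightUnitor _).hom, comm := by intro A; simp }
      inv := { φ := (Functor.rightUnitor _).inv, comm := by intro A; simp }
      hom_inv_id := by ext; simp
      inv_hom_id := by ext; simp }
  whiskerLeft_id := by intros; ext; simp
  whiskerLeft_comp := by intros; ext; simp
  id_whiskerLeft := by intros; ext; simp
  comp_whiskerLeft := by intros; ext; simp
  id_whiskerRight := by intros; ext; simp
  comp_whiskerRight := by intros; ext; simp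
  whiskerRight_id := by intros; ext; simp
  whiskerRight_comp := by intros; ext; simp
  whisker_assoc := by intros; ext; simp
  whisker_exchange := by intros; ext; simp
  pentagon := by intros; ext; simp
  triangle := by intros; ext; simp

lemma eqToHom_φ {X Y : Cmd.{v, u}} {f g : X ⟶ Y} (h : f = g) :
    Hom₂.φ (eqToHom h) = eqToHom (congrArg Hom.H h) := by
  subst h; rfl

@[simp] lemma id_H (X : Cmd.{v, u}) : Hom.H (𝟙 X) = 𝟭 X.C := rfl

@[simp] lemma id_θ_app (X : Cmd.{v, u}) (A : X.C) : (Hom.θ (𝟙 X)).app A = 𝟙 (X.K.obj A) := rfl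

@[simp] lemma comp_H {X Y Z : Cmd.{v, u}} (f : X ⟶ Y) (g : Y ⟶ Z) :
    Hom.H (f ≫ g) = Hom.H f ⋙ Hom.H g := rfl

@[simp] lemma comp_θ_app {X Y Z : Cmd.{v, u}} (f : X ⟶ Y) (g : Y ⟶ Z) (A : X.C) :
    (Hom.θ (f ≫ g)).app A = (Hom.H g).map ((Hom.θ f).app A) ≫ (Hom.θ g).app ((Hom.H f).obj A) :=
  rfl

instance : Bicategory.Strict Cmd.{v, u} where
  id_comp f := Hom.id_comp f
  comp_id f := Hom.comp_id f
  assoc f g h := Hom.assoc f g h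
  leftUnitor_eqToIso {a b} f := Iso.ext (hom_ext (eqToHom_φ (X := a) (Y := b) (Hom.id_comp f)).symm)
  rightUnitor_eqToIso {a b} f := Iso.ext (hom_ext (eqToHom_φ (X := a) (Y := b) (Hom.comp_id f)).symm)
  associator_eqToIso {a _ _ b} f g h :=
    Iso.ext (hom_ext (eqToHom_φ (X := a) (Y := b) (Hom.assoc f g h)).symm)
end Cmd

/-- An adjunction `L ⊣ R` with `L : D ⥤ C`: the objects of the 2-category of adjunctions. -/
structure AdjLoose : Type (max u v + 1) where
  C : Type (max u v)
  D : Type (max u v)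
  [catC : Category.{v} C]
  [catD : Category.{v} D]
  L : D ⥤ C
  R : C ⥤ D
  adj : L ⊣ R

attribute [instance] AdjLoose.catC AdjLoose.catD

namespace AdjLoose

/-- A left loose morphism of adjunctions `(F, G, ζ)`: functors `F`, `G` between the respective
categories and a natural isomorphism `ζ : L' G ≅ F L`. -/
structure Hom (X Y : AdjLoose.{v, u}) where
  F : X.C ⥤ Y.C
  G : X.D ⥤ Y.D
  ζ : G ⋙ Y.L ≅ X.L ⋙ F

/-- A 2-cell `(F₁, G₁, ζ₁) ⟶ (F₂, G₂, ζ₂)`: a pair `φ : F₁ ⟹ F₂`, `ψ : G₁ ⟹ G₂` with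
`φ L ∘ ζ₁ = ζ₂ ∘ L' ψ`. -/
@[ext]
structure Hom₂ {X Y : AdjLoose.{v, u}} (f g : Hom X Y) where
  φ : f.F ⟶ g.F
  ψ : f.G ⟶ g.G
  comm : ∀ A, f.ζ.hom.app A ≫ φ.app (X.L.obj A) = Y.L.map (ψ.app A) ≫ g.ζ.hom.app A

@[simps]
instance (X Y : AdjLoose.{v, u}) : Category (Hom X Y) where
  Hom := Hom₂
  id f := { φ := 𝟙 f.F, ψ := 𝟙 f.G, comm := by simp }
  comp a b :=
    { φ := a.φ ≫ b.φ
      ψ := a.ψ ≫ b.ψ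
      comm := by intro A; simp [reassoc_of% a.comm, b.comm] }

@[ext]
lemma hom_ext {X Y : AdjLoose.{v, u}} {f g : Hom X Y} {a b : f ⟶ g}
    (h : a.φ = b.φ) (h' : a.ψ = b.ψ) : a = b :=
  Hom₂.ext h h'

@[simps, reducible]
def Hom.id (X : AdjLoose.{v, u}) : Hom X X where
  F := 𝟭 _
  G := 𝟭 _
  ζ := Iso.refl _

@[simps, reducible]
def Hom.comp {X Y Z : AdjLoose.{v, u}} (f : Hom X Y) (g : Hom Y Z) : Hom X Z where
  F := f.F ⋙ g.F
  G := f.G ⋙ g.G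
  ζ := NatIso.ofComponents (fun A => g.ζ.app (f.G.obj A) ≪≫ g.F.mapIso (f.ζ.app A)) (by
    intro A B h
    have h1 := f.ζ.hom.naturality h
    have h2 := g.ζ.hom.naturality (f.G.map h)
    dsimp at h1 h2 ⊢
    rw [reassoc_of% h2, Category.assoc, ← g.F.map_comp, h1, g.F.map_comp])

lemma Hom.mk_congr {X Y : AdjLoose.{v, u}} {F : X.C ⥤ Y.C} {G : X.D ⥤ Y.D}
    {ζ ζ' : G ⋙ Y.L ≅ X.L ⋙ F} (h : ∀ A, ζ.hom.app A = ζ'.hom.app A) :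
    Hom.mk F G ζ = Hom.mk F G ζ' := by
  obtain rfl : ζ = ζ' := by ext A; exact h A
  rfl

lemma Hom.id_comp {X Y : AdjLoose.{v, u}} (f : Hom X Y) : (Hom.id X).comp f = f :=
  Hom.mk_congr (by intro A; simp)

lemma Hom.comp_id {X Y : AdjLoose.{v, u}} (f : Hom X Y) : f.comp (Hom.id Y) = f :=
  Hom.mk_congr (by intro A; simp)

lemma Hom.assoc {X Y Z W : AdjLoose.{v, u}} (f : Hom X Y) (g : Hom Y Z) (h : Hom Z W) :
    (f.comp g).comp h = f.comp (g.comp h) :=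
  Hom.mk_congr (by intro A; simp)

/-- The 2-category of adjunctions and left loose morphisms. The composite of `(F₁, G₁, ζ₁)` and
`(F₂, G₂, ζ₂)` is `(F₂ F₁, G₂ G₁, F₂ ζ₁ ∘ ζ₂ G₁)`. -/
instance : Bicategory.{max u v, max u v} AdjLoose.{v, u} where
  Hom := Hom
  id := Hom.id
  comp := Hom.comp
  homCategory X Y := inferInstance
  whiskerLeft {X Y Z} f {g h} a :=
    { φ := Functor.whiskerLeft f.F a.φ
      ψ := Functor.whiskerLeft f.G a.ψ
      comm := by
        intro A
        have h1 := a.φ.naturality (f.ζ.hom.app A)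
        have h2 := a.comm (f.G.obj A)
        dsimp at h1 h2
        dsimp
        rw [Category.assoc, h1, reassoc_of% h2] }
  whiskerRight {X Y Z} f g a h :=
    { φ := Functor.whiskerRight a.φ h.F
      ψ := Functor.whiskerRight a.ψ h.G
      comm := by
        intro A
        have h1 := h.ζ.hom.naturality (a.ψ.app A)
        have h2 := a.comm A
        dsimp at h1 h2
        dsimp
        rw [Category.assoc, ← h.F.map_comp, h2, h.F.map_comp, reassoc_of% h1] }
  associator f g h :=
    { hom := { φ := (Functor.associator _ _ _).hom, ψ := (Functor.associator _ _ _).hom,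
               comm := by intro A; simp }
      inv := { φ := (Functor.associator _ _ _).inv, ψ := (Functor.associator _ _ _).inv,
               comm := by intro A; simp }
      hom_inv_id := by ext <;> simp
      inv_hom_id := by ext <;> simp }
  leftUnitor f :=
    { hom := { φ := (Functor.leftUnitor _).hom, ψ := (Functor.leftUnitor _).hom,
               comm := by intro A; simp }
      inv := { φ := (Functor.leftUnitor _).inv, ψ := (Functor.leftUnitor _).inv,
               comm := by intro A; simp }
      hom_inv_id := by ext <;> simp
      inv_hom_id := by ext <;> simp }
  rightUnitor f :=
    { hom := { φ := (Functor.rightUnitor _).hom, ψ := (Functor.rightUnitor _).hom,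
               comm := by intro A; simp }
      inv := { φ := (Functor.rightUnitor _).inv, ψ := (Functor.rightUnitor _).inv,
               comm := by intro A; simp }
      hom_inv_id := by ext <;> simp
      inv_hom_id := by ext <;> simp }
  whiskerLeft_id := by intros; ext <;> simp
  whiskerLeft_comp := by intros; ext <;> simp
  id_whiskerLeft := by intros; ext <;> simp
  comp_whiskerLeft := by intros; ext <;> simp
  id_whiskerRight := by intros; ext <;> simp
  comp_whiskerRight := by intros; ext <;> simp
  whiskerRight_id := by intros; ext <;> simp
  whiskerRight_comp := by intros; ext <;> simp
  whisker_assoc := by intros; ext <;> simp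
  whisker_exchange := by intros; ext <;> simp
  pentagon := by intros; ext <;> simp
  triangle := by intros; ext <;> simp

lemma eqToHom_φ {X Y : AdjLoose.{v, u}} {f g : X ⟶ Y} (h : f = g) :
    Hom₂.φ (eqToHom h) = eqToHom (congrArg Hom.F h) := by
  subst h; rfl

lemma eqToHom_ψ {X Y : AdjLoose.{v, u}} {f g : X ⟶ Y} (h : f = g) :
    Hom₂.ψ (eqToHom h) = eqToHom (congrArg Hom.G h) := by
  subst h; rfl

instance : Bicategory.Strict AdjLoose.{v, u} where
  id_comp f := Hom.id_comp f
  comp_id f := Hom.comp_id f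
  assoc f g h := Hom.assoc f g h
  leftUnitor_eqToIso {a b} f :=
    Iso.ext (hom_ext (eqToHom_φ (X := a) (Y := b) (Hom.id_comp f)).symm
      (eqToHom_ψ (X := a) (Y := b) (Hom.id_comp f)).symm)
  rightUnitor_eqToIso {a b} f :=
    Iso.ext (hom_ext (eqToHom_φ (X := a) (Y := b) (Hom.comp_id f)).symm
      (eqToHom_ψ (X := a) (Y := b) (Hom.comp_id f)).symm)
  associator_eqToIso {a _ _ b} f g h :=
    Iso.ext (hom_ext (eqToHom_φ (X := a) (Y := b) (Hom.assoc f g h)).symm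
      (eqToHom_ψ (X := a) (Y := b) (Hom.assoc f g h)).symm)

/-- The mate `ζ^# : G R ⟹ R' F` of `ζ : L' G ≅ F L`. -/
@[simps]
def mate {X Y : AdjLoose.{v, u}} (f : Hom X Y) : X.R ⋙ f.G ⟶ f.F ⋙ Y.R where
  app A := Y.adj.unit.app (f.G.obj (X.R.obj A)) ≫ Y.R.map (f.ζ.hom.app (X.R.obj A)) ≫
    Y.R.map (f.F.map (X.adj.counit.app A))
  naturality A B h := by
    have h1 := f.ζ.hom.naturality (X.R.map h)
    have h2 := X.adj.counit.naturality h
    dsimp at h1 h2 ⊢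
    simp only [Category.assoc, ← Functor.map_comp]
    rw [← Adjunction.unit_naturality_assoc, ← Functor.map_comp, reassoc_of% h1, ← Functor.map_comp, h2]

lemma mate_eq_mateEquiv {X Y : AdjLoose.{v, u}} (f : Hom X Y) :
    mate f = (mateEquiv X.adj Y.adj (TwoSquare.mk _ _ _ _ f.ζ.hom)).natTrans := by
  ext A; simp

end AdjLoose

/-- `f` is a cartesian arrow with respect to `p`. -/
abbrev IsCart {B E : Type*} [Category B] [Category E] (p : E ⥤ B) {a b : E} (f : a ⟶ b) : Prop :=
  p.IsStronglyCartesian (p.map f) f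

/-- A Grothendieck fibration `p : E ⥤ B`. -/
structure Fib : Type (max u v + 1) where
  B : Type (max u v)
  E : Type (max u v)
  [catB : Category.{v} B]
  [catE : Category.{v} E]
  p : E ⥤ B
  isFibered : p.IsFibered

attribute [instance] Fib.catB Fib.catE

namespace Fib

/-- A morphism of fibrations: a strictly commutative square of functors whose upper functor preserves
cartesian arrows. -/
structure Hom (X Y : Fib.{v, u}) where
  base : X.B ⥤ Y.B
  top : X.E ⥤ Y.E
  w : top ⋙ Y.p = X.p ⋙ base
  cart : ∀ {a b : X.E} (f : a ⟶ b), IsCart X.p f → IsCart Y.p (top.map f)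

/-- A 2-cell: natural transformations `φ` between the upper and `ψ` between the lower functors such
that `φ` lies over `ψ`. -/
@[ext]
structure Hom₂ {X Y : Fib.{v, u}} (f g : Hom X Y) where
  ψ : f.base ⟶ g.base
  φ : f.top ⟶ g.top
  lifts : ∀ A, Y.p.IsHomLift (ψ.app (X.p.obj A)) (φ.app A)

@[simps]
instance (X Y : Fib.{v, u}) : Category (Hom X Y) where
  Hom := Hom₂
  id f := { ψ := 𝟙 f.base, φ := 𝟙 f.top, lifts A := IsHomLift.id (Functor.congr_obj f.w A) }
  comp a b :=
    { ψ := a.ψ ≫ b.ψ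
      φ := a.φ ≫ b.φ
      lifts A := by
        have := a.lifts A
        have := b.lifts A
        exact inferInstanceAs (Y.p.IsHomLift (_ ≫ _) (_ ≫ _)) }

@[ext]
lemma hom_ext {X Y : Fib.{v, u}} {f g : Hom X Y} {a b : f ⟶ g}
    (h : a.ψ = b.ψ) (h' : a.φ = b.φ) : a = b :=
  Hom₂.ext h h'

@[simps, reducible]
def Hom.id (X : Fib.{v, u}) : Hom X X where
  base := 𝟭 _
  top := 𝟭 _
  w := rfl
  cart _ h := h

@[simps, reducible]
def Hom.comp {X Y Z : Fib.{v, u}} (f : Hom X Y) (g : Hom Y Z) : Hom X Z where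
  base := f.base ⋙ g.base
  top := f.top ⋙ g.top
  w := by
    rw [Functor.assoc, g.w, ← Functor.assoc, f.w, Functor.assoc]
  cart h hh := g.cart _ (f.cart h hh)

lemma Hom.map_isHomLift {X Y : Fib.{v, u}} (f : Hom X Y) {R S : X.B} {a b : X.E} (h : R ⟶ S)
    (k : a ⟶ b) (hk : X.p.IsHomLift h k) : Y.p.IsHomLift (f.base.map h) (f.top.map k) := by
  obtain ⟨k⟩ := hk
  have := Functor.congr_hom f.w k
  dsimp at this
  exact IsHomLift.of_fac' Y.p _ _ (Functor.congr_obj f.w _) (Functor.congr_obj f.w _) this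

/-- The 2-category of fibrations. -/
instance : Bicategory.{max u v, max u v} Fib.{v, u} where
  Hom := Hom
  id := Hom.id
  comp := Hom.comp
  homCategory X Y := inferInstance
  whiskerLeft {X Y Z} f {g h} a :=
    { ψ := Functor.whiskerLeft f.base a.ψ
      φ := Functor.whiskerLeft f.top a.φ
      lifts A := by
        have := a.lifts (f.top.obj A)
        rwa [show Y.p.obj (f.top.obj A) = f.base.obj (X.p.obj A) from Functor.congr_obj f.w A]
          at this }
  whiskerRight {X Y Z} f g a h :=
    { ψ := Functor.whiskerRight a.ψ h.base
      φ := Functor.whiskerRight a.φ h.top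
      lifts A := h.map_isHomLift _ _ (a.lifts A) }
  associator f g h :=
    { hom := { ψ := (Functor.associator _ _ _).hom, φ := (Functor.associator _ _ _).hom,
               lifts := (𝟙 ((f.comp g).comp h) : Hom₂ _ _).lifts }
      inv := { ψ := (Functor.associator _ _ _).inv, φ := (Functor.associator _ _ _).inv,
               lifts := (𝟙 ((f.comp g).comp h) : Hom₂ _ _).lifts }
      hom_inv_id := by ext <;> simp
      inv_hom_id := by ext <;> simp }
  leftUnitor f :=
    { hom := { ψ := (Functor.leftUnitor _).hom, φ := (Functor.leftUnitor _).hom,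
               lifts := (𝟙 f : Hom₂ _ _).lifts }
      inv := { ψ := (Functor.leftUnitor _).inv, φ := (Functor.leftUnitor _).inv,
               lifts := (𝟙 f : Hom₂ _ _).lifts }
      hom_inv_id := by ext <;> simp
      inv_hom_id := by ext <;> simp }
  rightUnitor f :=
    { hom := { ψ := (Functor.rightUnitor _).hom, φ := (Functor.rightUnitor _).hom,
               lifts := (𝟙 f : Hom₂ _ _).lifts }
      inv := { ψ := (Functor.rightUnitor _).inv, φ := (Functor.rightUnitor _).inv,
               lifts := (𝟙 f : Hom₂ _ _).lifts }
      hom_inv_id := by ext <;> simp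
      inv_hom_id := by ext <;> simp }
  whiskerLeft_id := by intros; ext <;> simp
  whiskerLeft_comp := by intros; ext <;> simp
  id_whiskerLeft := by intros; ext <;> simp
  comp_whiskerLeft := by intros; ext <;> simp
  id_whiskerRight := by intros; ext <;> simp
  comp_whiskerRight := by intros; ext <;> simp
  whiskerRight_id := by intros; ext <;> simp
  whiskerRight_comp := by intros; ext <;> simp
  whisker_assoc := by intros; ext <;> simp
  whisker_exchange := by intros; ext <;> simp
  pentagon := by intros; ext <;> simp
  triangle := by intros; ext <;> simp

lemma eqToHom_φ {X Y : Fib.{v, u}} {f g : X ⟶ Y} (h : f = g) :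
    Hom₂.φ (eqToHom h) = eqToHom (congrArg Hom.top h) := by
  subst h; rfl

lemma eqToHom_ψ {X Y : Fib.{v, u}} {f g : X ⟶ Y} (h : f = g) :
    Hom₂.ψ (eqToHom h) = eqToHom (congrArg Hom.base h) := by
  subst h; rfl

instance : Bicategory.Strict Fib.{v, u} where
  id_comp _ := rfl
  comp_id _ := rfl
  assoc _ _ _ := rfl
  leftUnitor_eqToIso _ := Iso.ext (hom_ext rfl rfl)
  rightUnitor_eqToIso _ := Iso.ext (hom_ext rfl rfl)
  associator_eqToIso _ _ _ := Iso.ext (hom_ext rfl rfl)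

end Fib

/-- A fibration `p : E ⥤ B` with a weakening and contraction comonad: a comonad `K` on `E` whose
counit has cartesian components and such that, for each cartesian arrow `f : A ⟶ B`, the image under
`p` of the naturality square of the counit at `f` is a pullback. -/
structure WCCmd : Type (max u v + 1) where
  fib : Fib.{v, u}
  K : Comonad fib.E
  counit_cart : ∀ A, IsCart fib.p (K.ε.app A)
  isPullback : ∀ {A B : fib.E} (f : A ⟶ B), IsCart fib.p f →
    IsPullback (fib.p.map (K.ε.app A)) (fib.p.map (K.map f)) (fib.p.map f)
      (fib.p.map (K.ε.app B))

namespace WCCmd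

@[reducible]
def toCmd (X : WCCmd.{v, u}) : Cmd.{v, u} := ⟨X.fib.E, X.K⟩

/-- A lax morphism `(C, H, θ)` of weakening and contraction comonads: a morphism `(C, H)` of
fibrations with a lax morphism `(H, θ)` of comonads. -/
structure Hom (X Y : WCCmd.{v, u}) where
  fib : Fib.Hom X.fib Y.fib
  θ : X.K.toFunctor ⋙ fib.top ⟶ fib.top ⋙ Y.K.toFunctor
  counit : ∀ A, θ.app A ≫ Y.K.ε.app (fib.top.obj A) = fib.top.map (X.K.ε.app A)
  comult : ∀ A, θ.app A ≫ Y.K.δ.app (fib.top.obj A) =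
    fib.top.map (X.K.δ.app A) ≫ θ.app (X.K.obj A) ≫ Y.K.map (θ.app A)

@[reducible]
def Hom.toCmd {X Y : WCCmd.{v, u}} (f : Hom X Y) : Cmd.Hom X.toCmd Y.toCmd where
  H := f.fib.top
  θ := f.θ
  counit := f.counit
  comult := f.comult

/-- A 2-cell `(ψ, φ)` of fibrations such that `φ` is a 2-cell of comonads. -/
@[ext]
structure Hom₂ {X Y : WCCmd.{v, u}} (f g : Hom X Y) where
  fib : f.fib ⟶ g.fib
  comm : ∀ A, f.θ.app A ≫ Y.K.map (fib.φ.app A) = fib.φ.app (X.K.obj A) ≫ g.θ.app A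

@[reducible]
def Hom₂.toCmd {X Y : WCCmd.{v, u}} {f g : Hom X Y} (a : Hom₂ f g) : f.toCmd ⟶ g.toCmd where
  φ := a.fib.φ
  comm := a.comm

@[simps]
instance (X Y : WCCmd.{v, u}) : Category (Hom X Y) where
  Hom := Hom₂
  id f := { fib := 𝟙 f.fib, comm := Cmd.Hom₂.comm (𝟙 f.toCmd) }
  comp a b :=
    { fib := a.fib ≫ b.fib
      comm := Cmd.Hom₂.comm (a.toCmd ≫ b.toCmd) }
  id_comp a := Hom₂.ext (Category.id_comp a.fib)
  comp_id a := Hom₂.ext (Category.comp_id a.fib)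
  assoc a b c := Hom₂.ext (Category.assoc a.fib b.fib c.fib)

@[ext]
lemma hom_ext {X Y : WCCmd.{v, u}} {f g : Hom X Y} {a b : f ⟶ g}
    (h : a.fib = b.fib) : a = b :=
  Hom₂.ext h

@[simps, reducible]
def Hom.id (X : WCCmd.{v, u}) : Hom X X where
  fib := Fib.Hom.id _
  θ := (Cmd.Hom.id X.toCmd).θ
  counit := (Cmd.Hom.id X.toCmd).counit
  comult := (Cmd.Hom.id X.toCmd).comult

@[simps, reducible]
def Hom.comp {X Y Z : WCCmd.{v, u}} (f : Hom X Y) (g : Hom Y Z) : Hom X Z where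
  fib := f.fib.comp g.fib
  θ := (f.toCmd.comp g.toCmd).θ
  counit := (f.toCmd.comp g.toCmd).counit
  comult := (f.toCmd.comp g.toCmd).comult

lemma Hom.mk_congr {X Y : WCCmd.{v, u}} {F : Fib.Hom X.fib Y.fib}
    {θ θ' : X.K.toFunctor ⋙ F.top ⟶ F.top ⋙ Y.K.toFunctor} {c d c' d'}
    (h : ∀ A, θ.app A = θ'.app A) : Hom.mk F θ c d = Hom.mk F θ' c' d' := by
  obtain rfl : θ = θ' := by ext A; exact h A
  rfl

lemma Hom.id_comp {X Y : WCCmd.{v, u}} (f : Hom X Y) : (Hom.id X).comp f = f :=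
  Hom.mk_congr (by intro A; simp)

lemma Hom.comp_id {X Y : WCCmd.{v, u}} (f : Hom X Y) : f.comp (Hom.id Y) = f :=
  Hom.mk_congr (by intro A; simp)

lemma Hom.assoc {X Y Z W : WCCmd.{v, u}} (f : Hom X Y) (g : Hom Y Z) (h : Hom Z W) :
    (f.comp g).comp h = f.comp (g.comp h) :=
  Hom.mk_congr (by intro A; simp)

/-- An invertible 2-cell from its two underlying invertible 2-cells. -/
def isoMk {X Y : WCCmd.{v, u}} {f g : Hom X Y} (e : f.fib ≅ g.fib)
    (e' : f.toCmd ≅ g.toCmd) (h : e'.hom.φ = e.hom.φ) (h' : e'.inv.φ = e.inv.φ) : f ≅ g where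
  hom := { fib := e.hom, comm := by rw [← h]; exact e'.hom.comm }
  inv := { fib := e.inv, comm := by rw [← h']; exact e'.inv.comm }
  hom_inv_id := hom_ext e.hom_inv_id
  inv_hom_id := hom_ext e.inv_hom_id

/-- The 2-category of weakening and contraction comonads and lax morphisms. -/
instance : Bicategory.{max u v, max u v} WCCmd.{v, u} where
  Hom := Hom
  id := Hom.id
  comp := Hom.comp
  homCategory X Y := inferInstance
  whiskerLeft {X Y Z} f {g h} a :=
    { fib := whiskerLeft (B := Fib) (a := X.fib) (b := Y.fib) (c := Z.fib) f.fib a.fib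
      comm := Cmd.Hom₂.comm
        (whiskerLeft (B := Cmd) (a := X.toCmd) (b := Y.toCmd) (c := Z.toCmd) f.toCmd a.toCmd) }
  whiskerRight {X Y Z} f g a h :=
    { fib := whiskerRight (B := Fib) (a := X.fib) (b := Y.fib) (c := Z.fib) a.fib h.fib
      comm := Cmd.Hom₂.comm
        (whiskerRight (B := Cmd) (a := X.toCmd) (b := Y.toCmd) (c := Z.toCmd) a.toCmd h.toCmd) }
  associator {X Y Z W} f g h :=
    isoMk (associator (B := Fib) (a := X.fib) (b := Y.fib) (c := Z.fib) (d := W.fib) f.fib g.fib h.fib)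
      (associator (B := Cmd) (a := X.toCmd) (b := Y.toCmd) (c := Z.toCmd) (d := W.toCmd)
        f.toCmd g.toCmd h.toCmd) rfl rfl
  leftUnitor {X Y} f := isoMk (leftUnitor (B := Fib) (a := X.fib) (b := Y.fib) f.fib)
      (leftUnitor (B := Cmd) (a := X.toCmd) (b := Y.toCmd) f.toCmd) rfl rfl
  rightUnitor {X Y} f := isoMk (rightUnitor (B := Fib) (a := X.fib) (b := Y.fib) f.fib)
      (rightUnitor (B := Cmd) (a := X.toCmd) (b := Y.toCmd) f.toCmd) rfl rfl
  whiskerLeft_id _ _ := hom_ext (whiskerLeft_id (B := Fib) _ _)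
  whiskerLeft_comp _ _ _ _ _ _ := hom_ext (whiskerLeft_comp (B := Fib) _ _ _)
  id_whiskerLeft _ := hom_ext (id_whiskerLeft (B := Fib) _)
  comp_whiskerLeft _ _ _ _ _ := hom_ext (comp_whiskerLeft (B := Fib) _ _ _)
  id_whiskerRight _ _ := hom_ext (id_whiskerRight (B := Fib) _ _)
  comp_whiskerRight _ _ _ := hom_ext (comp_whiskerRight (B := Fib) _ _ _)
  whiskerRight_id _ := hom_ext (whiskerRight_id (B := Fib) _)
  whiskerRight_comp _ _ _ := hom_ext (whiskerRight_comp (B := Fib) _ _ _)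
  whisker_assoc _ _ _ _ _ := hom_ext (whisker_assoc (B := Fib) _ _ _)
  whisker_exchange _ _ := hom_ext (whisker_exchange (B := Fib) _ _)
  pentagon _ _ _ _ := hom_ext (pentagon (B := Fib) _ _ _ _)
  triangle _ _ := hom_ext (triangle (B := Fib) _ _)

lemma eqToHom_fib {X Y : WCCmd.{v, u}} {f g : X ⟶ Y} (h : f = g) :
    Hom₂.fib (eqToHom h) = eqToHom (congrArg Hom.fib h) := by
  subst h; rfl

instance : Bicategory.Strict WCCmd.{v, u} where
  id_comp f := Hom.id_comp f
  comp_id f := Hom.comp_id f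
  assoc f g h := Hom.assoc f g h
  leftUnitor_eqToIso {a b} f :=
    Iso.ext (hom_ext (eqToHom_fib (X := a) (Y := b) (Hom.id_comp f)).symm)
  rightUnitor_eqToIso {a b} f :=
    Iso.ext (hom_ext (eqToHom_fib (X := a) (Y := b) (Hom.comp_id f)).symm)
  associator_eqToIso {a _ _ b} f g h :=
    Iso.ext (hom_ext (eqToHom_fib (X := a) (Y := b) (Hom.assoc f g h)).symm)

end WCCmd


/-- A generalised category with families: fibrations `u : E ⥤ B` (types) and `du : T ⥤ B` (terms),
a morphism of fibrations `Σ = S : du ⟶ u` over `B`, and a right adjoint `Δ = D` of the functor `Σ`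
such that unit and counit have cartesian components. -/
structure GCwfLoose : Type (max u v + 1) where
  types : Fib.{v, u}
  T : Type (max u v)
  [catT : Category.{v} T]
  du : T ⥤ types.B
  du_isFibered : du.IsFibered
  S : T ⥤ types.E
  S_comp : S ⋙ types.p = du
  S_cart : ∀ {a b : T} (f : a ⟶ b), IsCart du f → IsCart types.p (S.map f)
  D : types.E ⥤ T
  adj : S ⊣ D
  unit_cart : ∀ a, IsCart du (adj.unit.app a)
  counit_cart : ∀ A, IsCart types.p (adj.counit.app A)

attribute [instance] GCwfLoose.catT

namespace GCwfLoose

@[reducible]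
def terms (X : GCwfLoose.{v, u}) : Fib.{v, u} := ⟨X.types.B, X.T, X.du, X.du_isFibered⟩

@[reducible]
def toAdj (X : GCwfLoose.{v, u}) : AdjLoose.{v, u} := ⟨X.types.E, X.T, X.S, X.D, X.adj⟩

/-- A loose morphism `(C, H, H', ζ)`: morphisms of fibrations `(C, H) : u ⟶ u₁` and
`(C, H') : du ⟶ du₁` over the same functor `C` of bases, and a natural isomorphism
`ζ : Σ₁ H' ≅ H Σ` which is vertical, that is, its components lie over identities. -/
structure Hom (X Y : GCwfLoose.{v, u}) where
  types : Fib.Hom X.types Y.types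
  G : X.T ⥤ Y.T
  G_comp : G ⋙ Y.du = X.du ⋙ types.base
  G_cart : ∀ {a b : X.T} (f : a ⟶ b), IsCart X.du f → IsCart Y.du (G.map f)
  ζ : G ⋙ Y.S ≅ X.S ⋙ types.top
  vertical : ∀ a, Y.types.p.IsHomLift (𝟙 (types.base.obj (X.du.obj a))) (ζ.hom.app a)

@[reducible]
def Hom.terms {X Y : GCwfLoose.{v, u}} (f : Hom X Y) : Fib.Hom X.terms Y.terms where
  base := f.types.base
  top := f.G
  w := f.G_comp
  cart := f.G_cart

@[reducible]
def Hom.toAdj {X Y : GCwfLoose.{v, u}} (f : Hom X Y) : AdjLoose.Hom X.toAdj Y.toAdj where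
  F := f.types.top
  G := f.G
  ζ := f.ζ

/-- A 2-cell: natural transformations `ψ`, `φ`, `φ'` such that `(ψ, φ)` and `(ψ, φ')` are 2-cells of
fibrations and `(φ, φ')` is a 2-cell of left loose morphisms of adjunctions. -/
@[ext]
structure Hom₂ {X Y : GCwfLoose.{v, u}} (f g : Hom X Y) where
  types : f.types ⟶ g.types
  φ' : f.G ⟶ g.G
  lifts : ∀ a, Y.du.IsHomLift (types.ψ.app (X.du.obj a)) (φ'.app a)
  comm : ∀ a, f.ζ.hom.app a ≫ types.φ.app (X.S.obj a) = Y.S.map (φ'.app a) ≫ g.ζ.hom.app a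

@[reducible]
def Hom₂.terms {X Y : GCwfLoose.{v, u}} {f g : Hom X Y} (a : Hom₂ f g) : f.terms ⟶ g.terms where
  ψ := a.types.ψ
  φ := a.φ'
  lifts := a.lifts

@[reducible]
def Hom₂.toAdj {X Y : GCwfLoose.{v, u}} {f g : Hom X Y} (a : Hom₂ f g) : f.toAdj ⟶ g.toAdj where
  φ := a.types.φ
  ψ := a.φ'
  comm := a.comm

@[simps]
instance (X Y : GCwfLoose.{v, u}) : Category (Hom X Y) where
  Hom := Hom₂
  id f :=
    { types := 𝟙 f.types
      φ' := 𝟙 f.G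
      lifts := Fib.Hom₂.lifts (𝟙 f.terms)
      comm := AdjLoose.Hom₂.comm (𝟙 f.toAdj) }
  comp a b :=
    { types := a.types ≫ b.types
      φ' := a.φ' ≫ b.φ'
      lifts := Fib.Hom₂.lifts (a.terms ≫ b.terms)
      comm := AdjLoose.Hom₂.comm (a.toAdj ≫ b.toAdj) }
  id_comp a := Hom₂.ext (Category.id_comp a.types) (Category.id_comp a.φ')
  comp_id a := Hom₂.ext (Category.comp_id a.types) (Category.comp_id a.φ')
  assoc a b c :=
    Hom₂.ext (Category.assoc a.types b.types c.types) (Category.assoc a.φ' b.φ' c.φ')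

@[ext]
lemma hom_ext {X Y : GCwfLoose.{v, u}} {f g : Hom X Y} {a b : f ⟶ g}
    (h : a.types = b.types) (h' : a.φ' = b.φ') : a = b :=
  Hom₂.ext h h'

@[simps, reducible]
def Hom.id (X : GCwfLoose.{v, u}) : Hom X X where
  types := Fib.Hom.id _
  G := 𝟭 _
  G_comp := rfl
  G_cart _ h := h
  ζ := Iso.refl _
  vertical a := IsHomLift.id (Functor.congr_obj X.S_comp a)

@[simps, reducible]
def Hom.comp {X Y Z : GCwfLoose.{v, u}} (f : Hom X Y) (g : Hom Y Z) : Hom X Z where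
  types := f.types.comp g.types
  G := f.G ⋙ g.G
  G_comp := (f.terms.comp g.terms).w
  G_cart := (f.terms.comp g.terms).cart
  ζ := (f.toAdj.comp g.toAdj).ζ
  vertical a := by
    have h1 := g.vertical (f.G.obj a)
    have h2 := g.types.map_isHomLift _ _ (f.vertical a)
    rw [show Y.du.obj (f.G.obj a) = f.types.base.obj (X.du.obj a) from
      Functor.congr_obj f.G_comp a] at h1
    rw [CategoryTheory.Functor.map_id] at h2
    have h3 := @IsHomLift.comp_of_lift_id _ _ _ _ Z.types.p _ _ _ _ _ _ h1 h2
    exact h3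

lemma Hom.mk_congr {X Y : GCwfLoose.{v, u}} {F : Fib.Hom X.types Y.types} {G : X.T ⥤ Y.T}
    {ζ ζ' : G ⋙ Y.S ≅ X.S ⋙ F.top} {c d e c' d' e'}
    (h : ∀ A, ζ.hom.app A = ζ'.hom.app A) : Hom.mk F G c d ζ e = Hom.mk F G c' d' ζ' e' := by
  obtain rfl : ζ = ζ' := by ext A; exact h A
  rfl

lemma Hom.id_comp {X Y : GCwfLoose.{v, u}} (f : Hom X Y) : (Hom.id X).comp f = f :=
  Hom.mk_congr (by intro A; simp)

lemma Hom.comp_id {X Y : GCwfLoose.{v, u}} (f : Hom X Y) : f.comp (Hom.id Y) = f :=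
  Hom.mk_congr (by intro A; simp)

lemma Hom.assoc {X Y Z W : GCwfLoose.{v, u}} (f : Hom X Y) (g : Hom Y Z) (h : Hom Z W) :
    (f.comp g).comp h = f.comp (g.comp h) :=
  Hom.mk_congr (by intro A; simp)

/-- An invertible 2-cell from its underlying invertible 2-cells. -/
def isoMk {X Y : GCwfLoose.{v, u}} {f g : Hom X Y} (e : f.types ≅ g.types)
    (e₁ : f.terms ≅ g.terms) (e₂ : f.toAdj ≅ g.toAdj)
    (h : e₁.hom.ψ = e.hom.ψ ∧ e₂.hom.φ = e.hom.φ ∧ e₂.hom.ψ = e₁.hom.φ)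
    (h' : e₁.inv.ψ = e.inv.ψ ∧ e₂.inv.φ = e.inv.φ ∧ e₂.inv.ψ = e₁.inv.φ) : f ≅ g where
  hom :=
    { types := e.hom
      φ' := e₁.hom.φ
      lifts := by rw [← h.1]; exact e₁.hom.lifts
      comm := by rw [← h.2.1, ← h.2.2]; exact e₂.hom.comm }
  inv :=
    { types := e.inv
      φ' := e₁.inv.φ
      lifts := by rw [← h'.1]; exact e₁.inv.lifts
      comm := by rw [← h'.2.1, ← h'.2.2]; exact e₂.inv.comm }
  hom_inv_id := hom_ext e.hom_inv_id (congrArg Fib.Hom₂.φ e₁.hom_inv_id)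
  inv_hom_id := hom_ext e.inv_hom_id (congrArg Fib.Hom₂.φ e₁.inv_hom_id)

/-- Equality of 2-cells of fibrations gives equality of the two components. -/
lemma φ_congr {X Y : Fib.{v, u}} {f g : X ⟶ Y} {a b : f ⟶ g} (h : a = b) :
    Fib.Hom₂.φ a = Fib.Hom₂.φ b := by rw [h]

/-- The 2-category of gcwfs and loose morphisms. -/
instance : Bicategory.{max u v, max u v} GCwfLoose.{v, u} where
  Hom := Hom
  id := Hom.id
  comp := Hom.comp
  homCategory X Y := inferInstance
  whiskerLeft {X Y Z} f {g h} a :=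
    { types := whiskerLeft (B := Fib) (a := X.types) (b := Y.types) (c := Z.types) f.types a.types
      φ' := Functor.whiskerLeft f.G a.φ'
      lifts := Fib.Hom₂.lifts
        (whiskerLeft (B := Fib) (a := X.terms) (b := Y.terms) (c := Z.terms) f.terms a.terms)
      comm := AdjLoose.Hom₂.comm
        (whiskerLeft (B := AdjLoose) (a := X.toAdj) (b := Y.toAdj) (c := Z.toAdj) f.toAdj a.toAdj) }
  whiskerRight {X Y Z} f g a h :=
    { types := whiskerRight (B := Fib) (a := X.types) (b := Y.types) (c := Z.types) a.types h.types
      φ' := Functor.whiskerRight a.φ' h.G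
      lifts := Fib.Hom₂.lifts
        (whiskerRight (B := Fib) (a := X.terms) (b := Y.terms) (c := Z.terms) a.terms h.terms)
      comm := AdjLoose.Hom₂.comm
        (whiskerRight (B := AdjLoose) (a := X.toAdj) (b := Y.toAdj) (c := Z.toAdj)
          a.toAdj h.toAdj) }
  associator {X Y Z W} f g h :=
    isoMk (associator (B := Fib) (a := X.types) (b := Y.types) (c := Z.types) (d := W.types)
        f.types g.types h.types)
      (associator (B := Fib) (a := X.terms) (b := Y.terms) (c := Z.terms) (d := W.terms)
        f.terms g.terms h.terms)
      (associator (B := AdjLoose) (a := X.toAdj) (b := Y.toAdj) (c := Z.toAdj) (d := W.toAdj)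
        f.toAdj g.toAdj h.toAdj) ⟨rfl, rfl, rfl⟩ ⟨rfl, rfl, rfl⟩
  leftUnitor {X Y} f :=
    isoMk (leftUnitor (B := Fib) (a := X.types) (b := Y.types) f.types)
      (leftUnitor (B := Fib) (a := X.terms) (b := Y.terms) f.terms)
      (leftUnitor (B := AdjLoose) (a := X.toAdj) (b := Y.toAdj) f.toAdj)
      ⟨rfl, rfl, rfl⟩ ⟨rfl, rfl, rfl⟩
  rightUnitor {X Y} f :=
    isoMk (rightUnitor (B := Fib) (a := X.types) (b := Y.types) f.types)
      (rightUnitor (B := Fib) (a := X.terms) (b := Y.terms) f.terms)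
      (rightUnitor (B := AdjLoose) (a := X.toAdj) (b := Y.toAdj) f.toAdj)
      ⟨rfl, rfl, rfl⟩ ⟨rfl, rfl, rfl⟩
  whiskerLeft_id _ _ := hom_ext (whiskerLeft_id (B := Fib) _ _) (by ext; simp)
  whiskerLeft_comp _ _ _ _ _ _ := hom_ext (whiskerLeft_comp (B := Fib) _ _ _) (by ext; simp)
  id_whiskerLeft {X Y} f g η := hom_ext (id_whiskerLeft (B := Fib) _)
    (φ_congr (id_whiskerLeft (B := Fib) (a := X.terms) (b := Y.terms) η.terms))
  comp_whiskerLeft {X Y Z W} f g h h' η := hom_ext (comp_whiskerLeft (B := Fib) _ _ _)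
    (φ_congr (comp_whiskerLeft (B := Fib) (a := X.terms) (b := Y.terms) (c := Z.terms) (d := W.terms)
      f.terms g.terms η.terms))
  id_whiskerRight _ _ := hom_ext (id_whiskerRight (B := Fib) _ _) (by ext; simp)
  comp_whiskerRight _ _ _ := hom_ext (comp_whiskerRight (B := Fib) _ _ _) (by ext; simp)
  whiskerRight_id {X Y} f g η := hom_ext (whiskerRight_id (B := Fib) _)
    (φ_congr (whiskerRight_id (B := Fib) (a := X.terms) (b := Y.terms) η.terms))
  whiskerRight_comp {X Y Z W} _ _ η g h := hom_ext (whiskerRight_comp (B := Fib) _ _ _)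
    (φ_congr (whiskerRight_comp (B := Fib) (a := X.terms) (b := Y.terms) (c := Z.terms)
      (d := W.terms) η.terms g.terms h.terms))
  whisker_assoc {X Y Z W} f _ _ η h := hom_ext (whisker_assoc (B := Fib) _ _ _)
    (φ_congr (whisker_assoc (B := Fib) (a := X.terms) (b := Y.terms) (c := Z.terms)
      (d := W.terms) f.terms η.terms h.terms))
  whisker_exchange {X Y Z} _ _ _ _ η θ := hom_ext (whisker_exchange (B := Fib) _ _)
    (φ_congr (whisker_exchange (B := Fib) (a := X.terms) (b := Y.terms) (c := Z.terms)
      η.terms θ.terms))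
  pentagon {X Y Z W V} f g h i := hom_ext (pentagon (B := Fib) _ _ _ _)
    (φ_congr (pentagon (B := Fib) (a := X.terms) (b := Y.terms) (c := Z.terms)
      (d := W.terms) (e := V.terms) f.terms g.terms h.terms i.terms))
  triangle {X Y Z} f g := hom_ext (triangle (B := Fib) _ _)
    (φ_congr (triangle (B := Fib) (a := X.terms) (b := Y.terms) (c := Z.terms) f.terms g.terms))

lemma eqToHom_types {X Y : GCwfLoose.{v, u}} {f g : X ⟶ Y} (h : f = g) :
    Hom₂.types (eqToHom h) = eqToHom (congrArg Hom.types h) := by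
  subst h; rfl

lemma eqToHom_φ' {X Y : GCwfLoose.{v, u}} {f g : X ⟶ Y} (h : f = g) :
    Hom₂.φ' (eqToHom h) = eqToHom (congrArg Hom.G h) := by
  subst h; rfl

instance : Bicategory.Strict GCwfLoose.{v, u} where
  id_comp f := Hom.id_comp f
  comp_id f := Hom.comp_id f
  assoc f g h := Hom.assoc f g h
  leftUnitor_eqToIso {a b} f :=
    Iso.ext (hom_ext (eqToHom_types (X := a) (Y := b) (Hom.id_comp f)).symm
      (eqToHom_φ' (X := a) (Y := b) (Hom.id_comp f)).symm)
  rightUnitor_eqToIso {a b} f :=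
    Iso.ext (hom_ext (eqToHom_types (X := a) (Y := b) (Hom.comp_id f)).symm
      (eqToHom_φ' (X := a) (Y := b) (Hom.comp_id f)).symm)
  associator_eqToIso {a _ _ b} f g h :=
    Iso.ext (hom_ext (eqToHom_types (X := a) (Y := b) (Hom.assoc f g h)).symm
      (eqToHom_φ' (X := a) (Y := b) (Hom.assoc f g h)).symm)

end GCwfLoose

section Coalgebra

variable {C : Type*} [Category C] {K : Comonad C}

lemma coalgebra_eqToHom_f {A B : K.Coalgebra} (h : A = B) :
    (eqToHom h).f = eqToHom (congrArg Comonad.Coalgebra.A h) := by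
  subst h; rfl

lemma coalgebra_hom_heq {A B A' B' : K.Coalgebra} (hA : A = A') (hB : B = B') (f : A ⟶ B)
    (g : A' ⟶ B') (h : f.f ≍ g.f) : f ≍ g := by
  subst hA hB
  exact heq_of_eq (Comonad.Coalgebra.Hom.ext (eq_of_heq h))

end Coalgebra

/-- The Eilenberg--Moore adjunction of a comonad: the unit at a coalgebra `(A, a)` is `a`, and the
counit is the counit of the comonad. -/
@[reducible]
def emAdj {C : Type*} [Category C] (K : Comonad C) : K.forget ⊣ K.cofree where
  unit :=
    { app A := { f := A.a, h := A.coassoc.symm }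
      naturality A B f := by ext; exact f.h.symm }
  counit := { app A := K.ε.app A, naturality A B f := K.ε.naturality f }
  left_triangle_components A := A.counit
  right_triangle_components A := by ext; exact K.right_counit A

/-- The functor on coalgebras induced by `(H, θ)`: it maps `(A, a)` to `(H A, θ_A ∘ H a)`. -/
@[simps, reducible]
def Cmd.coalg {X Y : Cmd.{v, u}} (f : Cmd.Hom X Y) : X.K.Coalgebra ⥤ Y.K.Coalgebra where
  obj A :=
    { A := f.H.obj A.A
      a := f.H.map A.a ≫ f.θ.app A.A
      counit := by
        rw [Category.assoc, f.counit, ← f.H.map_comp, A.counit, f.H.map_id]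
      coassoc := by
        have h := f.θ.naturality A.a
        dsimp at h
        rw [Category.assoc, f.comult, ← f.H.map_comp_assoc, A.coassoc]
        simp only [Category.assoc, Functor.map_comp, reassoc_of% h] }
  map g :=
    { f := f.H.map g.f
      h := by
        have h := f.θ.naturality g.f
        dsimp at h ⊢
        rw [Category.assoc, ← h, ← f.H.map_comp_assoc, ← f.H.map_comp_assoc, g.h] }

/-- The natural transformation on coalgebras induced by a 2-cell `φ`, with the same components. -/
@[simps]
def Cmd.coalg₂ {X Y : Cmd.{v, u}} {f g : Cmd.Hom X Y} (a : f ⟶ g) : coalg f ⟶ coalg g where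
  app A :=
    { f := a.φ.app A.A
      h := by
        have h1 := a.comm A.A
        have h2 := a.φ.naturality A.a
        dsimp at h1 h2 ⊢
        rw [Category.assoc, h1, ← reassoc_of% h2] }

lemma AdjLoose.Hom.mk_congr' {X Y : AdjLoose.{v, u}} {F : X.C ⥤ Y.C} {G G' : X.D ⥤ Y.D}
    {ζ : G ⋙ Y.L ≅ X.L ⋙ F} {ζ' : G' ⋙ Y.L ≅ X.L ⋙ F} (hG : G = G')
    (h : ∀ A, ζ.hom.app A ≍ ζ'.hom.app A) :
    Hom.mk F G ζ = Hom.mk F G' ζ' := by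
  subst hG
  exact Hom.mk_congr fun A => eq_of_heq (h A)

lemma Cmd.coalg_id (X : Cmd.{v, u}) : coalg (Hom.id X) = 𝟭 _ :=
  Functor.hext (fun A => by cases A; simp [coalg]) fun A B f =>
    coalgebra_hom_heq (by cases A; simp [coalg]) (by cases B; simp [coalg]) _ _ HEq.rfl

lemma Cmd.coalg_comp {X Y Z : Cmd.{v, u}} (f : Hom X Y) (g : Hom Y Z) :
    coalg (f.comp g) = coalg f ⋙ coalg g :=
  Functor.hext (fun A => by simp [coalg]) fun A B f =>
    coalgebra_hom_heq (by simp [coalg]) (by simp [coalg]) _ _ HEq.rfl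


lemma natTrans_heq {C D : Type*} [Category C] [Category D] {F G F' G' : C ⥤ D} (hF : F = F')
    (hG : G = G') (a : F ⟶ G) (b : F' ⟶ G') (h : ∀ A, a.app A ≍ b.app A) : a ≍ b := by
  subst hF hG
  exact heq_of_eq (NatTrans.ext (funext fun A => eq_of_heq (h A)))

lemma AdjLoose.eq_eqToHom_comp {X Y : AdjLoose.{v, u}} {f g f' g' : X ⟶ Y} (h : f = f')
    (h' : g' = g) (a : f ⟶ g) (b : f' ⟶ g') (hφ : Hom₂.φ a ≍ Hom₂.φ b)
    (hψ : Hom₂.ψ a ≍ Hom₂.ψ b) : a = eqToHom h ≫ b ≫ eqToHom h' := by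
  subst h h'
  rw [eqToHom_refl, eqToHom_refl, Category.id_comp, Category.comp_id]
  exact AdjLoose.hom_ext (eq_of_heq hφ) (eq_of_heq hψ)

lemma Cmd.eq_eqToHom_comp {X Y : Cmd.{v, u}} {f g f' g' : X ⟶ Y} (h : f = f')
    (h' : g' = g) (a : f ⟶ g) (b : f' ⟶ g') (hφ : Hom₂.φ a ≍ Hom₂.φ b) :
    a = eqToHom h ≫ b ≫ eqToHom h' := by
  subst h h'
  rw [eqToHom_refl, eqToHom_refl, Category.id_comp, Category.comp_id]
  exact Cmd.hom_ext (eq_of_heq hφ)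

/-- The left morphism of Eilenberg--Moore adjunctions induced by a lax morphism of comonads. -/
@[reducible]
def Cmd.emHom {X Y : Cmd.{v, u}} (f : Hom X Y) :
    AdjLoose.Hom ⟨X.C, X.K.Coalgebra, X.K.forget, X.K.cofree, emAdj X.K⟩
      ⟨Y.C, Y.K.Coalgebra, Y.K.forget, Y.K.cofree, emAdj Y.K⟩ where
  F := f.H
  G := coalg f
  ζ := Iso.refl _

/-- The 2-functor from comonads to adjunctions that sends a comonad to its Eilenberg--Moore
adjunction. -/
def cmdToAdj : StrictPseudofunctor Cmd.{v, u} AdjLoose.{v, u} :=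
  StrictPseudofunctor.mk''
    { obj X := ⟨X.C, X.K.Coalgebra, X.K.forget, X.K.cofree, emAdj X.K⟩
      map f := Cmd.emHom f
      map₂ a :=
        { φ := a.φ
          ψ := Cmd.coalg₂ a
          comm _ := (Category.id_comp _).trans (Category.comp_id _).symm }
      map₂_id _ := AdjLoose.hom_ext rfl rfl
      map₂_comp _ _ := AdjLoose.hom_ext rfl rfl
      map_id X := AdjLoose.Hom.mk_congr' (Cmd.coalg_id X) (by
        intro A
        exact HEq.rfl)
      map_comp f g := AdjLoose.Hom.mk_congr' (Cmd.coalg_comp f g) (by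
        intro A
        exact heq_of_eq
          ((Category.id_comp _).trans (CategoryTheory.Functor.map_id (Cmd.Hom.H g) _)).symm)
      map₂_whisker_left f _ _ η := AdjLoose.eq_eqToHom_comp _ _ _ _ HEq.rfl
        (natTrans_heq (Cmd.coalg_comp _ _) (Cmd.coalg_comp _ _) _ _ fun A =>
          coalgebra_hom_heq (Functor.congr_obj (Cmd.coalg_comp _ _) A)
            (Functor.congr_obj (Cmd.coalg_comp _ _) A) _ _ HEq.rfl)
      map₂_whisker_right η f := AdjLoose.eq_eqToHom_comp _ _ _ _ HEq.rfl
        (natTrans_heq (Cmd.coalg_comp _ _) (Cmd.coalg_comp _ _) _ _ fun A =>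
          coalgebra_hom_heq (Functor.congr_obj (Cmd.coalg_comp _ _) A)
            (Functor.congr_obj (Cmd.coalg_comp _ _) A) _ _ HEq.rfl) }


lemma map₂_whiskerLeft_eq {A : Type u₁} [Bicategory.{w₁, v₁} A] {B : Type u₂}
    [Bicategory.{w₂, v₂} B] (F : StrictPseudofunctor A B) {X Y Z : A} (f : X ⟶ Y)
    {g g' : Y ⟶ Z} (a : g ⟶ g') : F.map₂ (f ◁ a) =
      eqToHom (F.map_comp f g) ≫ F.map f ◁ F.map₂ a ≫ eqToHom (F.map_comp f g').symm := by
  rw [F.map₂_whisker_left, F.mapComp_eq_eqToIso, F.mapComp_eq_eqToIso]; rfl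

lemma map₂_whiskerRight_eq {A : Type u₁} [Bicategory.{w₁, v₁} A] {B : Type u₂}
    [Bicategory.{w₂, v₂} B] (F : StrictPseudofunctor A B) {X Y Z : A} {f f' : X ⟶ Y}
    (a : f ⟶ f') (g : Y ⟶ Z) : F.map₂ (a ▷ g) =
      eqToHom (F.map_comp f g) ≫ F.map₂ a ▷ F.map g ≫ eqToHom (F.map_comp f' g).symm := by
  rw [F.map₂_whisker_right, F.mapComp_eq_eqToIso, F.mapComp_eq_eqToIso]; rfl

/-- A class of 1-cells that contains the identities and is closed under composition. -/
structure OneCellClass (B : Type u₁) [Bicategory.{w₁, v₁} B] where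
  P : ∀ {X Y : B}, (X ⟶ Y) → Prop
  id_mem : ∀ X : B, P (𝟙 X)
  comp_mem : ∀ {X Y Z : B} (f : X ⟶ Y) (g : Y ⟶ Z), P f → P g → P (f ≫ g)

/-- The wide and 2-full sub-bicategory on a class `W` of 1-cells: all objects, the 1-cells in `W`, and
all 2-cells between them. -/
@[ext]
structure WideSub {B : Type u₁} [Bicategory.{w₁, v₁} B] (W : OneCellClass B) where
  of : B

namespace WideSub

section

variable {B : Type u₁} [Bicategory.{w₁, v₁} B] {W : OneCellClass B}

@[ext]
structure Hom (X Y : WideSub W) where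
  toHom : X.of ⟶ Y.of
  mem : W.P toHom

instance (X Y : WideSub W) : Category (Hom X Y) where
  Hom f g := f.toHom ⟶ g.toHom
  id f := 𝟙 f.toHom
  comp a b := CategoryStruct.comp (obj := X.of ⟶ Y.of) a b
  id_comp a := Category.id_comp (obj := X.of ⟶ Y.of) a
  comp_id a := Category.comp_id (obj := X.of ⟶ Y.of) a
  assoc a b c := Category.assoc (obj := X.of ⟶ Y.of) a b c

@[reducible]
def Hom.isoMk {X Y : WideSub W} {f g : Hom X Y} (e : f.toHom ≅ g.toHom) : f ≅ g where
  hom := e.hom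
  inv := e.inv
  hom_inv_id := e.hom_inv_id
  inv_hom_id := e.inv_hom_id

@[reducible]
def Hom.id (X : WideSub W) : Hom X X := ⟨𝟙 X.of, W.id_mem _⟩

@[reducible]
def Hom.comp {X Y Z : WideSub W} (f : Hom X Y) (g : Hom Y Z) : Hom X Z :=
  ⟨f.toHom ≫ g.toHom, W.comp_mem _ _ f.mem g.mem⟩

instance : Bicategory.{w₁, v₁} (WideSub W) where
  Hom := Hom
  id := Hom.id
  comp := Hom.comp
  homCategory _ _ := inferInstance
  whiskerLeft f _ _ a := whiskerLeft (B := B) f.toHom a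
  whiskerRight a h := whiskerRight (B := B) a h.toHom
  associator f g h := Hom.isoMk (α_ f.toHom g.toHom h.toHom)
  leftUnitor f := Hom.isoMk (λ_ f.toHom)
  rightUnitor f := Hom.isoMk (ρ_ f.toHom)
  whiskerLeft_id _ _ := whiskerLeft_id (B := B) _ _
  whiskerLeft_comp _ _ _ _ _ _ := whiskerLeft_comp (B := B) _ _ _
  id_whiskerLeft _ := id_whiskerLeft (B := B) _
  comp_whiskerLeft _ _ _ _ _ := comp_whiskerLeft (B := B) _ _ _
  id_whiskerRight _ _ := id_whiskerRight (B := B) _ _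
  comp_whiskerRight _ _ _ := comp_whiskerRight (B := B) _ _ _
  whiskerRight_id _ := whiskerRight_id (B := B) _
  whiskerRight_comp _ _ _ := whiskerRight_comp (B := B) _ _ _
  whisker_assoc _ _ _ _ _ := whisker_assoc (B := B) _ _ _
  whisker_exchange _ _ := whisker_exchange (B := B) _ _
  pentagon _ _ _ _ := pentagon (B := B) _ _ _ _
  triangle _ _ := triangle (B := B) _ _

/-- The underlying 2-cell of the ambient bicategory. -/
abbrev down {X Y : WideSub W} {f g : X ⟶ Y} (a : f ⟶ g) : Hom.toHom f ⟶ Hom.toHom g := a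

lemma down_eqToHom {X Y : WideSub W} {f g : X ⟶ Y} (h : f = g) :
    down (eqToHom h) = eqToHom (congrArg Hom.toHom h) := by
  subst h; rfl

lemma isoMk_eq_eqToIso {X Y : WideSub W} {f g : X ⟶ Y} (h : f = g)
    (e : Hom.toHom f ≅ Hom.toHom g) (he : e = eqToIso (congrArg Hom.toHom h)) :
    (Hom.isoMk e : f ≅ g) = eqToIso h := by
  subst h he; rfl

lemma eq_eqToHom_comp {X Y : WideSub W} {f g f' g' : X ⟶ Y} (h : f = f') (h' : g' = g)
    (a : f ⟶ g) (b : f' ⟶ g')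
    (hab : down a = eqToHom (congrArg Hom.toHom h) ≫ down b ≫ eqToHom (congrArg Hom.toHom h')) :
    a = eqToHom h ≫ b ≫ eqToHom h' := by
  subst h h'
  rw [eqToHom_refl, eqToHom_refl, Category.id_comp, Category.comp_id]
  simpa using hab

instance [Strict B] : Strict (WideSub W) where
  id_comp f := Hom.ext (Strict.id_comp f.toHom)
  comp_id f := Hom.ext (Strict.comp_id f.toHom)
  assoc f g h := Hom.ext (Strict.assoc f.toHom g.toHom h.toHom)
  leftUnitor_eqToIso f := isoMk_eq_eqToIso _ _ (Strict.leftUnitor_eqToIso f.toHom)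
  rightUnitor_eqToIso f := isoMk_eq_eqToIso _ _ (Strict.rightUnitor_eqToIso f.toHom)
  associator_eqToIso f g h := isoMk_eq_eqToIso _ _ (Strict.associator_eqToIso f.toHom g.toHom h.toHom)

variable (W) in
/-- The inclusion of a wide 2-full sub-2-category. -/
def incl [Strict B] : StrictPseudofunctor (WideSub W) B :=
  StrictPseudofunctor.mk''
    { obj X := X.of
      map f := f.toHom
      map₂ a := down a
      map₂_id _ := rfl
      map₂_comp _ _ := rfl
      map_id _ := rfl
      map_comp _ _ := rfl
      map₂_whisker_left _ _ _ _ := by simp; rfl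
      map₂_whisker_right _ _ := by simp; rfl }

/-- Corestriction of a 2-functor to a wide 2-full sub-2-category. -/
def lift {A : Type u₂} [Bicategory.{w₂, v₂} A] [Strict A] [Strict B] (F : StrictPseudofunctor A B)
    (W : OneCellClass B) (h : ∀ {X Y : A} (f : X ⟶ Y), W.P (F.map f)) :
    StrictPseudofunctor A (WideSub W) :=
  StrictPseudofunctor.mk''
    { obj X := ⟨F.obj X⟩
      map f := ⟨F.map f, h f⟩
      map₂ a := F.map₂ a
      map₂_id f := F.map₂_id f
      map₂_comp a b := F.map₂_comp a b
      map_id X := Hom.ext (F.map_id X)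
      map_comp f g := Hom.ext (F.map_comp f g)
      map₂_whisker_left f _ _ a := by
        refine eq_eqToHom_comp (W := W) (f := ⟨F.map _, h _⟩) (g := ⟨F.map _, h _⟩)
          (Hom.ext (F.map_comp _ _)) (Hom.ext (F.map_comp _ _).symm) _ _ ?_
        exact map₂_whiskerLeft_eq F f a
      map₂_whisker_right a f := by
        refine eq_eqToHom_comp (W := W) (f := ⟨F.map _, h _⟩) (g := ⟨F.map _, h _⟩)
          (Hom.ext (F.map_comp _ _)) (Hom.ext (F.map_comp _ _).symm) _ _ ?_
        exact map₂_whiskerRight_eq F a f }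

end
end WideSub


section

variable {B : Type u₁} [Bicategory.{w₁, v₁} B] {C : Type u₂} [Bicategory.{w₂, v₂} C]

/-- A strong transformation between strict pseudofunctors into a strict bicategory. -/
@[simps]
def mkStrongTrans [Strict C] (F G : StrictPseudofunctor B C)
    (app : ∀ X, F.obj X ⟶ G.obj X)
    (nat : ∀ {X Y : B} (f : X ⟶ Y), F.map f ≫ app Y ≅ app X ≫ G.map f)
    (nat_nat : ∀ {X Y : B} {f g : X ⟶ Y} (a : f ⟶ g),
      F.map₂ a ▷ app Y ≫ (nat g).hom = (nat f).hom ≫ app X ◁ G.map₂ a)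
    (nat_id : ∀ X, IsIdentity (nat (𝟙 X)).hom)
    (nat_comp : ∀ {X Y Z : B} (f : X ⟶ Y) (g : Y ⟶ Z), ∃ h₁ h₂ h₃,
      (nat (f ≫ g)).hom = eqToHom h₁ ≫ F.map f ◁ (nat g).hom ≫ eqToHom h₂ ≫
        (nat f).hom ▷ G.map g ≫ eqToHom h₃) :
    Pseudofunctor.StrongTrans F.toPseudofunctor G.toPseudofunctor where
  app := app
  naturality := nat
  naturality_naturality := nat_nat
  naturality_id X := by
    obtain ⟨h, hX⟩ := nat_id X
    rw [hX, F.mapId_eq_eqToIso, G.mapId_eq_eqToIso]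
    simp [Strict.leftUnitor_eqToIso, Strict.rightUnitor_eqToIso, whiskerLeft_eqToHom,
      eqToHom_whiskerRight]
  naturality_comp f g := by
    obtain ⟨h₁, h₂, h₃, h⟩ := nat_comp f g
    rw [h, F.mapComp_eq_eqToIso, G.mapComp_eq_eqToIso]
    simp [Strict.associator_eqToIso, whiskerLeft_eqToHom, eqToHom_whiskerRight]


lemma naturality_id_isIdentity [Strict C] {F G : StrictPseudofunctor B C}
    (u : Pseudofunctor.StrongTrans F.toPseudofunctor G.toPseudofunctor) (X : B) :
    IsIdentity (u.naturality (𝟙 X)).hom := by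
  have h := u.naturality_id X
  rw [F.mapId_eq_eqToIso, G.mapId_eq_eqToIso] at h
  simp only [eqToIso.hom, Strict.leftUnitor_eqToIso, Strict.rightUnitor_eqToIso,
    whiskerLeft_eqToHom, eqToHom_whiskerRight, eqToIso.inv, eqToHom_trans] at h
  rw [comp_eqToHom_iff, eqToHom_trans] at h
  exact ⟨_, h⟩

lemma naturality_comp_eq [Strict C] {F G : StrictPseudofunctor B C}
    (u : Pseudofunctor.StrongTrans F.toPseudofunctor G.toPseudofunctor) {X Y Z : B}
    (f : X ⟶ Y) (g : Y ⟶ Z) : ∃ h₁ h₂ h₃,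
      (u.naturality (f ≫ g)).hom = eqToHom h₁ ≫ F.map f ◁ (u.naturality g).hom ≫ eqToHom h₂ ≫
        (u.naturality f).hom ▷ G.map g ≫ eqToHom h₃ := by
  have h := u.naturality_comp f g
  rw [F.mapComp_eq_eqToIso, G.mapComp_eq_eqToIso] at h
  simp only [eqToIso.hom, Strict.associator_eqToIso,
    whiskerLeft_eqToHom, eqToHom_whiskerRight, eqToIso.inv, eqToHom_trans_assoc] at h
  rw [comp_eqToHom_iff] at h
  simp only [Category.assoc, eqToHom_trans] at h
  exact ⟨_, _, _, h⟩

/-- Strict pseudofunctors are equal as soon as they act equally on cells. -/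
lemma strictPseudofunctor_ext {F G : StrictPseudofunctor B C}
    (h : F.toPrelaxFunctor = G.toPrelaxFunctor) : F = G := by
  rcases F with ⟨⟨⟨F, i, c, _, _, _, _, _⟩, m, hi⟩, m', hc⟩
  rcases G with ⟨⟨⟨G, i', c', _, _, _, _, _⟩, n, hi'⟩, n', hc'⟩
  dsimp at h hi hi' hc hc'
  subst h
  obtain rfl : i = i' := by funext X; rw [hi, hi']
  obtain rfl : @c = @c' := by funext X Y Z f g; rw [hc, hc']
  rfl

end

namespace WideSub

variable {B : Type u₁} [Bicategory.{w₁, v₁} B] {C : Type u₂} [Bicategory.{w₂, v₂} C]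
  [Strict B] [Strict C]

/-- The inclusion between the wide 2-full sub-2-categories of two nested classes of 1-cells. -/
def inclOfLE {W W' : OneCellClass B} (h : ∀ {X Y : B} (f : X ⟶ Y), W.P f → W'.P f) :
    StrictPseudofunctor (WideSub W) (WideSub W') :=
  lift (incl W) W' fun f => h _ (Hom.mem f)

/-- Restriction of a 2-functor to wide 2-full sub-2-categories. -/
def restrict (F : StrictPseudofunctor B C) (W : OneCellClass B) (W' : OneCellClass C)
    (h : ∀ {X Y : B} (f : X ⟶ Y), W.P f → W'.P (F.map f)) :
    StrictPseudofunctor (WideSub W) (WideSub W') :=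
  lift ((incl W).comp F) W' fun f => h _ (Hom.mem f)

end WideSub

/-- A bireflection with counit the identity: 2-functors `R : C ⟶ D` and `L : D ⟶ C` with `L R = Id`,
a pseudonatural transformation `η : Id ⟹ R L`, and such that `L η` and `η R` are identities, as
pseudonatural transformations, so that `η` and the identity `L R = Id` are unit and counit of a
biadjunction `L ⊣ R` with identities as triangulators. The swallowtail condition then says that the
2-cell component of `η` at the 1-cell `η_X` is an identity. (The other swallowtail condition is
implied.) -/
structure Bireflection (C : Type u₁) [Bicategory.{w₁, v₁} C] (D : Type u₂)
    [Bicategory.{w₂, v₂} D] where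
  R : StrictPseudofunctor C D
  L : StrictPseudofunctor D C
  unit : Pseudofunctor.StrongTrans (StrictPseudofunctor.id D).toPseudofunctor
    (L.comp R).toPseudofunctor
  counit : R.comp L = StrictPseudofunctor.id C
  left_triangle : ∀ X : D, IsIdentity (L.map (unit.app X))
  left_triangle₂ : ∀ {X Y : D} (f : X ⟶ Y), IsIdentity (L.map₂ (unit.naturality f).hom)
  right_triangle : ∀ Z : C, IsIdentity (unit.app (R.obj Z))
  right_triangle₂ : ∀ {Z W : C} (h : Z ⟶ W), IsIdentity (unit.naturality (R.map h)).hom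
  swallowtail : ∀ X : D, IsIdentity (unit.naturality (unit.app X)).hom

namespace Bireflection

variable {C : Type u₁} [Bicategory.{w₁, v₁} C] {D : Type u₂} [Bicategory.{w₂, v₂} D]

/-- A 2-reflection: the unit is strictly 2-natural, so that `L ⊣ R` is a 2-adjunction. -/
def Is2Reflection (β : Bireflection C D) : Prop :=
  ∀ {X Y : D} (f : X ⟶ Y), IsIdentity (β.unit.naturality f).hom

/-- The bireflection is an adjoint biequivalence: the components of the unit are equivalences. (The
counit is an identity.) -/
def IsBiequivalence (β : Bireflection C D) : Prop :=
  ∀ X : D, ∃ e : Bicategory.Equivalence X (β.R.obj (β.L.obj X)), e.hom = β.unit.app X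

/-- `β` lifts `β₀` along the 2-functors `U` and `V`: right adjoints, left adjoints and units (on
objects and on 1-cells) commute with `U` and `V`, on the nose. If `U` and `V` are inclusions of
sub-2-categories, this says that `β` is the restriction of `β₀`. -/
structure Lifts {C₀ : Type u₃} [Bicategory.{w₃, v₃} C₀] {D₀ : Type u₄} [Bicategory.{w₄, v₄} D₀]
    (β : Bireflection C D) (β₀ : Bireflection C₀ D₀)
    (U : StrictPseudofunctor C C₀) (V : StrictPseudofunctor D D₀) : Prop where
  R : β.R.comp V = U.comp β₀.R
  L : β.L.comp U = V.comp β₀.L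
  unit : ∀ X, V.map (β.unit.app X) ≍ β₀.unit.app (V.obj X)
  unit₂ : ∀ {X Y : D} (f : X ⟶ Y),
    V.map₂ (β.unit.naturality f).hom ≍ (β₀.unit.naturality (V.map f)).hom

/-- The bireflection lives over the 2-category `E`: both adjoints commute with the given 2-functors
into `E`, and these send the unit to an identity. -/
structure IsOver {E : Type u₃} [Bicategory.{w₃, v₃} E] (β : Bireflection C D)
    (P : StrictPseudofunctor C E) (Q : StrictPseudofunctor D E) : Prop where
  R : β.R.comp Q = P
  L : β.L.comp P = Q
  unit : ∀ X, IsIdentity (Q.map (β.unit.app X))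
  unit₂ : ∀ {X Y : D} (f : X ⟶ Y), IsIdentity (Q.map₂ (β.unit.naturality f).hom)

section

variable {W : OneCellClass D}

lemma isIdentity_of_down {X Y : WideSub W} {f g : X ⟶ Y} (a : f ⟶ g)
    (h : IsIdentity (WideSub.down a)) : IsIdentity a := by
  obtain ⟨h₁, h₂⟩ := h
  exact ⟨WideSub.Hom.ext h₁, h₂.trans (WideSub.down_eqToHom (WideSub.Hom.ext h₁)).symm⟩

lemma eq_eqToHom_comp₂ {X Y : WideSub W} {f g f₁ g₁ f₂ g₂ : X ⟶ Y} (h₁ : f = f₁) (h₂ : g₁ = f₂)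
    (h₃ : g₂ = g) (a : f ⟶ g) (b : f₁ ⟶ g₁) (c : f₂ ⟶ g₂)
    (h : WideSub.down a = eqToHom (congrArg WideSub.Hom.toHom h₁) ≫ WideSub.down b ≫
      eqToHom (congrArg WideSub.Hom.toHom h₂) ≫ WideSub.down c ≫
      eqToHom (congrArg WideSub.Hom.toHom h₃)) :
    a = eqToHom h₁ ≫ b ≫ eqToHom h₂ ≫ c ≫ eqToHom h₃ := by
  subst h₁ h₂ h₃
  simp only [eqToHom_refl, Category.id_comp, Category.comp_id] at h ⊢
  exact h

lemma isIdentity_mk {X Y : WideSub W} (f : X ⟶ Y)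
    (h : IsIdentity (WideSub.Hom.toHom f)) : IsIdentity f := by
  obtain ⟨X⟩ := X
  obtain ⟨Y⟩ := Y
  obtain ⟨h₁, h₂⟩ := h
  dsimp at h₁
  subst h₁
  exact ⟨rfl, WideSub.Hom.ext h₂⟩

end

/-- Restriction of a bireflection to a wide 2-full sub-2-category on the right-hand side. -/
def restrictRight [Strict C] [Strict D] (β : Bireflection C D) (W : OneCellClass D)
    (hR : ∀ {X Y : C} (f : X ⟶ Y), W.P (β.R.map f)) (hu : ∀ X, W.P (β.unit.app X)) :
    Bireflection C (WideSub W) where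
  R := WideSub.lift β.R W hR
  L := (WideSub.incl W).comp β.L
  unit := mkStrongTrans _ _ (fun X => ⟨β.unit.app X.of, hu _⟩)
    (fun f => WideSub.Hom.isoMk (β.unit.naturality (WideSub.Hom.toHom f)))
    (fun a => β.unit.naturality_naturality (WideSub.down a))
    (fun X => isIdentity_of_down _ (naturality_id_isIdentity β.unit X.of))
    (fun f g => by
      obtain ⟨h₁, h₂, h₃, h⟩ := naturality_comp_eq β.unit (WideSub.Hom.toHom f) (WideSub.Hom.toHom g)
      exact ⟨_, _, _, eq_eqToHom_comp₂ (WideSub.Hom.ext h₁) (WideSub.Hom.ext h₂)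
        (WideSub.Hom.ext h₃) _ _ _ h⟩)
  counit := strictPseudofunctor_ext (congrArg (fun F => F.toPrelaxFunctor) β.counit)
  left_triangle X := β.left_triangle X.of
  left_triangle₂ f := β.left_triangle₂ (WideSub.Hom.toHom f)
  right_triangle X := isIdentity_mk _ (β.right_triangle X)
  right_triangle₂ f := isIdentity_of_down _ (β.right_triangle₂ f)
  swallowtail X := isIdentity_of_down _ (β.swallowtail X.of)

end Bireflection

namespace AdjLoose

/-- The comonad `(L R, ε, L η R)` of an adjunction. -/
@[reducible]
def toCmd (X : AdjLoose.{v, u}) : Cmd.{v, u} := ⟨X.C, X.adj.toComonad⟩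

section

variable {X Y : AdjLoose.{v, u}} (f : Hom X Y)

lemma unit_mate (A : X.D) :
    f.G.map (X.adj.unit.app A) ≫ (mate f).app (X.L.obj A) =
      Y.adj.unit.app (f.G.obj A) ≫ Y.R.map (f.ζ.hom.app A) := by
  have h1 := f.ζ.hom.naturality (X.adj.unit.app A)
  have h2 := Y.adj.unit.naturality (f.G.map (X.adj.unit.app A))
  dsimp only [Functor.comp_obj, Functor.comp_map, Functor.id_obj, Functor.id_map] at h1 h2
  dsimp only [mate]
  rw [reassoc_of% h2, ← Functor.map_comp, ← Functor.map_comp, reassoc_of% h1, ← Functor.map_comp,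
    X.adj.left_triangle_components, CategoryTheory.Functor.map_id, Category.comp_id]

lemma mate_counit (A : X.C) :
    Y.L.map ((mate f).app A) ≫ Y.adj.counit.app (f.F.obj A) =
      f.ζ.hom.app (X.R.obj A) ≫ f.F.map (X.adj.counit.app A) := by
  simp

/-- The natural transformation `L' ζ^# ∘ ζ⁻¹ R`. -/
@[simps]
def θ : (X.R ⋙ X.L) ⋙ f.F ⟶ f.F ⋙ (Y.R ⋙ Y.L) where
  app A := f.ζ.inv.app (X.R.obj A) ≫ Y.L.map ((mate f).app A)
  naturality A B h := by
    have h1 := f.ζ.inv.naturality (X.R.map h)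
    have h2 := (mate f).naturality h
    dsimp only [Functor.comp_obj, Functor.comp_map] at h1 h2 ⊢
    rw [reassoc_of% h1, Category.assoc, ← Functor.map_comp, h2, Functor.map_comp]

lemma θ_counit (A : X.C) :
    (θ f).app A ≫ Y.adj.counit.app (f.F.obj A) = f.F.map (X.adj.counit.app A) := by
  dsimp only [θ]
  rw [Category.assoc, mate_counit, Iso.inv_hom_id_app_assoc]

lemma ζ_θ (A : X.D) : f.ζ.hom.app A ≫ f.F.map (X.L.map (X.adj.unit.app A)) ≫
    (θ f).app (X.L.obj A) =
      Y.L.map (Y.adj.unit.app (f.G.obj A)) ≫ Y.L.map (Y.R.map (f.ζ.hom.app A)) := by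
  have h1 := f.ζ.hom.naturality (X.adj.unit.app A)
  dsimp only [Functor.comp_obj, Functor.comp_map, θ] at h1 ⊢
  rw [← reassoc_of% h1, Iso.hom_inv_id_app_assoc, ← Functor.map_comp, unit_mate, Functor.map_comp]

lemma θ_comult (A : X.C) :
    (θ f).app A ≫ Y.L.map (Y.adj.unit.app (Y.R.obj (f.F.obj A))) =
      f.F.map (X.L.map (X.adj.unit.app (X.R.obj A))) ≫ (θ f).app (X.L.obj (X.R.obj A)) ≫
        Y.L.map (Y.R.map ((θ f).app A)) := by
  have h1 := ζ_θ f (X.R.obj A)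
  have h2 := Y.adj.unit.naturality ((mate f).app A)
  dsimp only [Functor.comp_obj, Functor.comp_map, Functor.id_obj, Functor.id_map] at h1 h2
  rw [← cancel_epi (f.ζ.hom.app (X.R.obj A)), reassoc_of% h1]
  simp only [θ_app, Category.assoc, Iso.hom_inv_id_app_assoc]
  simp only [← Functor.map_comp]
  rw [h2]
  simp only [Iso.hom_inv_id_app_assoc]

lemma θ_comm {f g : Hom X Y} (a : f ⟶ g) (A : X.C) :
    (θ f).app A ≫ Y.L.map (Y.R.map (a.φ.app A)) =
      a.φ.app (X.L.obj (X.R.obj A)) ≫ (θ g).app A := by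
  have h1 := a.comm (X.R.obj A)
  have h2 := Y.adj.unit.naturality (a.ψ.app (X.R.obj A))
  have h3 := a.φ.naturality (X.adj.counit.app A)
  rw [← cancel_epi (f.ζ.hom.app (X.R.obj A)), reassoc_of% h1]
  dsimp only [Functor.comp_obj, Functor.comp_map, Functor.id_obj, Functor.id_map] at h1 h2 h3
  simp only [θ_app, Category.assoc, Iso.hom_inv_id_app_assoc]
  simp only [← Functor.map_comp]
  congr 1
  simp only [mate_app, Category.assoc]
  rw [reassoc_of% h2]
  simp only [← Functor.map_comp]
  rw [h3, ← reassoc_of% h1]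

end

/-- A left loose morphism induces a lax morphism of comonads with `θ = L' ζ^# ∘ ζ⁻¹ R`. -/
@[reducible]
def homToCmd {X Y : AdjLoose.{v, u}} (f : Hom X Y) : Cmd.Hom X.toCmd Y.toCmd where
  H := f.F
  θ := θ f
  counit := θ_counit f
  comult := θ_comult f

lemma θ_id (X : AdjLoose.{v, u}) (A : X.C) : (θ (Hom.id X)).app A = 𝟙 _ := by
  simp

lemma mate_comp {X Y Z : AdjLoose.{v, u}} (f : Hom X Y) (g : Hom Y Z) (A : X.C) :
    (mate (f.comp g)).app A = g.G.map ((mate f).app A) ≫ (mate g).app (f.F.obj A) := by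
  have h1 := Z.adj.unit.naturality (g.G.map ((mate f).app A))
  have h2 := g.ζ.hom.naturality ((mate f).app A)
  have h3 := mate_counit f A
  dsimp only [Functor.comp_obj, Functor.comp_map, Functor.id_obj, Functor.id_map] at h1 h2 h3
  rw [mate_app g, reassoc_of% h1, ← Functor.map_comp, ← Functor.map_comp, reassoc_of% h2,
    ← Functor.map_comp, h3]
  simp

lemma θ_comp {X Y Z : AdjLoose.{v, u}} (f : Hom X Y) (g : Hom Y Z) (A : X.C) :
    (θ (f.comp g)).app A = g.F.map ((θ f).app A) ≫ (θ g).app (f.F.obj A) := by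
  have h2 := g.ζ.inv.naturality ((mate f).app A)
  dsimp only [Functor.comp_obj, Functor.comp_map] at h2
  simp only [θ_app, mate_comp, Functor.map_comp, Category.assoc, NatIso.ofComponents_inv_app]
  rw [reassoc_of% h2]
  simp

end AdjLoose

/-- The 2-functor from adjunctions to comonads: it sends `L ⊣ R` to the comonad `L R`, a left loose
morphism `(F, G, ζ)` to `(F, L' ζ^# ∘ ζ⁻¹ R)`, and a 2-cell `(φ, ψ)` to `φ`. -/
def adjToCmd : StrictPseudofunctor AdjLoose.{v, u} Cmd.{v, u} :=
  StrictPseudofunctor.mk''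
    { obj X := X.toCmd
      map f := AdjLoose.homToCmd f
      map₂ a := { φ := AdjLoose.Hom₂.φ a, comm := AdjLoose.θ_comm a }
      map₂_id _ := Cmd.hom_ext rfl
      map₂_comp _ _ := Cmd.hom_ext rfl
      map_id X := Cmd.Hom.mk_congr fun A => AdjLoose.θ_id X A
      map_comp f g := Cmd.Hom.mk_congr fun A => AdjLoose.θ_comp f g A
      map₂_whisker_left _ _ _ _ := Cmd.eq_eqToHom_comp _ _ _ _ HEq.rfl
      map₂_whisker_right _ _ := Cmd.eq_eqToHom_comp _ _ _ _ HEq.rfl }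

section
variable {B : Type u₁} [Bicategory.{w₁, v₁} B] {C : Type u₂} [Bicategory.{w₂, v₂} C]

lemma strictPseudofunctor_hext {F G : StrictPseudofunctor B C} (h₀ : ∀ X, F.obj X = G.obj X)
    (h₁ : ∀ {X Y : B} (f : X ⟶ Y), F.map f ≍ G.map f)
    (h₂ : ∀ {X Y : B} {f g : X ⟶ Y} (a : f ⟶ g), F.map₂ a ≍ G.map₂ a) : F = G := by
  apply strictPseudofunctor_ext
  rcases F with ⟨⟨⟨⟨⟨⟨o, m⟩, m₂⟩, _, _⟩, _, _, _, _, _, _, _⟩, _, _⟩, _, _⟩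
  rcases G with ⟨⟨⟨⟨⟨⟨o', m'⟩, m₂'⟩, _, _⟩, _, _, _, _, _, _, _⟩, _, _⟩, _, _⟩
  dsimp at h₀ h₁ h₂ ⊢
  obtain rfl : o = o' := funext h₀
  obtain rfl : @m = @m' := by
    funext X Y f; exact eq_of_heq (h₁ f)
  obtain rfl : @m₂ = @m₂' := by
    funext X Y f g a; exact eq_of_heq (h₂ a)
  rfl

end

lemma Cmd.hom₂_heq {X Y : Cmd.{v, u}} {f g f' g' : X ⟶ Y} (h : f = f')
    (h' : g = g') (a : f ⟶ g) (b : f' ⟶ g') (hφ : Hom₂.φ a ≍ Hom₂.φ b) : a ≍ b := by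
  subst h h'
  exact heq_of_eq (Cmd.hom_ext (eq_of_heq hφ))

lemma Cmd.homToCmd_emHom {X Y : Cmd.{v, u}} (f : Cmd.Hom X Y) :
    AdjLoose.homToCmd (Cmd.emHom f) = f := by
  refine Cmd.Hom.mk_congr (θ' := f.θ) fun A => ?_
  have h1 := f.θ.naturality (X.K.ε.app A)
  dsimp only [Functor.comp_obj, Functor.comp_map, Functor.id_obj] at h1
  change 𝟙 _ ≫ (f.H.map (X.K.δ.app A) ≫ f.θ.app (X.K.obj A)) ≫ Y.K.map (𝟙 _) ≫
    Y.K.map (f.H.map (X.K.ε.app A)) = f.θ.app A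
  dsimp only [Functor.comp_obj]
  rw [CategoryTheory.Functor.map_id, Category.id_comp, Category.assoc, Category.id_comp, ← h1,
    ← f.H.map_comp_assoc, X.K.right_counit, CategoryTheory.Functor.map_id, Category.id_comp]

lemma cmdToAdj_adjToCmd : cmdToAdj.{v, u}.comp adjToCmd = StrictPseudofunctor.id _ :=
  strictPseudofunctor_hext (fun _ => rfl) (fun f => heq_of_eq (Cmd.homToCmd_emHom f))
    fun _ => Cmd.hom₂_heq (Cmd.homToCmd_emHom _) (Cmd.homToCmd_emHom _) _ _ HEq.rfl

/-- The left morphism of adjunctions given by the identity and by the Eilenberg--Moore comparison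
functor, which sends `A` to the coalgebra `(L A, L η_A)`. -/
@[reducible]
def AdjLoose.comparison (X : AdjLoose.{v, u}) :
    AdjLoose.Hom X ((adjToCmd.comp cmdToAdj).obj X) where
  F := 𝟭 _
  G := Comonad.comparison X.adj
  ζ := Iso.refl X.L

/-- The lift of `ζ` to coalgebras. -/
@[reducible]
def AdjLoose.ζHat {X Y : AdjLoose.{v, u}} (f : AdjLoose.Hom X Y) :
    f.G ⋙ Comonad.comparison Y.adj ≅ Comonad.comparison X.adj ⋙ Cmd.coalg (homToCmd f) :=
  NatIso.ofComponents (fun A => Comonad.Coalgebra.isoMk (f.ζ.app A) (by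
    exact (ζ_θ f A).symm)) (by
    intro A B h
    ext
    exact f.ζ.hom.naturality h)


lemma AdjLoose.hom₂_heq {X Y : AdjLoose.{v, u}} {f g f' g' : X ⟶ Y} (h : f = f')
    (h' : g = g') (a : f ⟶ g) (b : f' ⟶ g') (hφ : Hom₂.φ a ≍ Hom₂.φ b)
    (hψ : Hom₂.ψ a ≍ Hom₂.ψ b) : a ≍ b := by
  subst h h'
  exact heq_of_eq (AdjLoose.hom_ext (eq_of_heq hφ) (eq_of_heq hψ))

lemma AdjLoose.eq_eqToHom_comp₂ {X Y : AdjLoose.{v, u}} {f g f₁ g₁ f₂ g₂ : X ⟶ Y} (h₁ : f = f₁)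
    (h₂ : g₁ = f₂) (h₃ : g₂ = g) (a : f ⟶ g) (b : f₁ ⟶ g₁) (c : f₂ ⟶ g₂)
    (hφ : ∀ A, (Hom₂.φ a).app A ≍ (Hom₂.φ b).app A ≫ eqToHom (by rw [h₂]) ≫ (Hom₂.φ c).app A)
    (hψ : ∀ A, (Hom₂.ψ a).app A ≍ (Hom₂.ψ b).app A ≫ eqToHom (by rw [h₂]) ≫ (Hom₂.ψ c).app A) :
    a = eqToHom h₁ ≫ b ≫ eqToHom h₂ ≫ c ≫ eqToHom h₃ := by
  subst h₁ h₂ h₃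
  simp only [eqToHom_refl, Category.id_comp, Category.comp_id] at hφ hψ ⊢
  refine AdjLoose.hom_ext ?_ ?_
  · ext A; exact eq_of_heq (hφ A)
  · ext A; exact eq_of_heq (hψ A)

lemma AdjLoose.isIdentity_mk {X Y : AdjLoose.{v, u}} {f g : X ⟶ Y} (h : f = g) (a : f ⟶ g)
    (hφ : ∀ A, (Hom₂.φ a).app A ≍ 𝟙 ((Hom.F f).obj A))
    (hψ : ∀ A, (Hom₂.ψ a).app A ≍ 𝟙 ((Hom.G f).obj A)) : IsIdentity a := by
  subst h
  refine ⟨rfl, AdjLoose.hom_ext ?_ ?_⟩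
  · ext A; exact eq_of_heq (hφ A)
  · ext A; exact eq_of_heq (hψ A)

lemma Cmd.isIdentity_mk {X Y : Cmd.{v, u}} {f g : X ⟶ Y} (h : f = g) (a : f ⟶ g)
    (hφ : ∀ A, (Hom₂.φ a).app A ≍ 𝟙 ((Hom.H f).obj A)) : IsIdentity a := by
  subst h
  refine ⟨rfl, Cmd.hom_ext ?_⟩
  ext A; exact eq_of_heq (hφ A)

/-- The invertible 2-cell `(id, ζ)` that makes the comparison functors pseudonatural. -/
@[reducible]
def AdjLoose.unitNat {X Y : AdjLoose.{v, u}} (f : X ⟶ Y) :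
    f ≫ comparison Y ≅ comparison X ≫ (adjToCmd.comp cmdToAdj).map f where
  hom :=
    { φ := 𝟙 (Hom.F f)
      ψ := (ζHat f).hom
      comm A := by
        change (𝟙 _ ≫ (Hom.ζ f).hom.app A) ≫ 𝟙 _ = (Hom.ζ f).hom.app A ≫ 𝟙 _ ≫ (Hom.F f).map (𝟙 _)
        rw [CategoryTheory.Functor.map_id]; simp }
  inv :=
    { φ := 𝟙 (Hom.F f)
      ψ := (ζHat f).inv
      comm A := by
        change (𝟙 _ ≫ (Hom.F f).map (𝟙 _)) ≫ 𝟙 _ = (Hom.ζ f).inv.app A ≫ 𝟙 _ ≫ (Hom.ζ f).hom.app A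
        rw [CategoryTheory.Functor.map_id]; simp }
  hom_inv_id := AdjLoose.hom_ext (Category.id_comp (𝟙 (Hom.F f))) (ζHat f).hom_inv_id
  inv_hom_id := AdjLoose.hom_ext (Category.id_comp (𝟙 (Hom.F f))) (ζHat f).inv_hom_id

lemma AdjLoose.comparison_em (X : Cmd.{v, u}) :
    comparison (cmdToAdj.obj X) = 𝟙 (cmdToAdj.obj X) :=
  Hom.mk_congr' (Functor.hext (fun A => by cases A; rfl) fun A B f =>
    coalgebra_hom_heq (by cases A; rfl) (by cases B; rfl) _ _ HEq.rfl) fun A => HEq.rfl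

lemma AdjLoose.unitNat_id (X : AdjLoose.{v, u}) :
    𝟙 X ≫ comparison X = comparison X ≫ (adjToCmd.comp cmdToAdj).map (𝟙 X) :=
  (Strict.id_comp _).trans ((Strict.comp_id _).symm.trans
    (congrArg (comparison X ≫ ·) ((adjToCmd.comp cmdToAdj).map_id X).symm))

lemma AdjLoose.unitNat_comp {X Y Z : AdjLoose.{v, u}} (f : X ⟶ Y) (g : Y ⟶ Z) :
    (comparison X ≫ (adjToCmd.comp cmdToAdj).map f) ≫ (adjToCmd.comp cmdToAdj).map g =
      comparison X ≫ (adjToCmd.comp cmdToAdj).map (f ≫ g) :=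
  (Strict.assoc _ _ _).trans
    (congrArg (comparison X ≫ ·) ((adjToCmd.comp cmdToAdj).map_comp f g).symm)

lemma AdjLoose.left_triangle (X : AdjLoose.{v, u}) :
    adjToCmd.map (comparison X) = 𝟙 (adjToCmd.obj X) :=
  Cmd.Hom.mk_congr fun (A : X.C) => by
    have h : 𝟙 (X.L.obj (X.R.obj A)) ≫ X.L.map (X.adj.unit.app (X.R.obj A)) ≫
        X.L.map (X.R.map (𝟙 (X.L.obj (X.R.obj A)))) ≫
          X.L.map (X.R.map (X.adj.counit.app A)) = 𝟙 _ := by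
      simp [← Functor.map_comp]
    exact h

lemma adjToCmd_cmdToAdj_map {X Y : Cmd.{v, u}} (f : X ⟶ Y) :
    adjToCmd.map (cmdToAdj.map f) = f :=
  Cmd.homToCmd_emHom f

lemma AdjLoose.left_triangle_naturality {X Y : AdjLoose.{v, u}} (f : X ⟶ Y) :
    adjToCmd.map (f ≫ comparison Y) =
      adjToCmd.map (comparison X ≫ (adjToCmd.comp cmdToAdj).map f) := by
  have h : adjToCmd.map ((adjToCmd.comp cmdToAdj).map f) = adjToCmd.map f :=
    adjToCmd_cmdToAdj_map (adjToCmd.map f)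
  refine (adjToCmd.map_comp _ _).trans (Eq.trans ?_ (adjToCmd.map_comp _ _).symm)
  rw [left_triangle, left_triangle, h]
  exact (Strict.comp_id _).trans (Strict.id_comp _).symm

lemma AdjLoose.unit_naturality_em {X Y : Cmd.{v, u}} (f : X ⟶ Y) :
    cmdToAdj.map f ≫ comparison (cmdToAdj.obj Y) =
      comparison (cmdToAdj.obj X) ≫ (adjToCmd.comp cmdToAdj).map (cmdToAdj.map f) := by
  have h : (adjToCmd.comp cmdToAdj).map (cmdToAdj.map f) = cmdToAdj.map f :=
    congrArg cmdToAdj.map (adjToCmd_cmdToAdj_map f)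
  rw [comparison_em, comparison_em, h]
  exact (Strict.comp_id _).trans (Strict.id_comp _).symm

lemma AdjLoose.unit_naturality_comparison (X : AdjLoose.{v, u}) :
    comparison X ≫ comparison ((adjToCmd.comp cmdToAdj).obj X) =
      comparison X ≫ (adjToCmd.comp cmdToAdj).map (comparison X) := by
  have h : (adjToCmd.comp cmdToAdj).map (comparison X) = 𝟙 ((adjToCmd.comp cmdToAdj).obj X) :=
    (congrArg cmdToAdj.map (left_triangle X)).trans (cmdToAdj.map_id _)
  rw [h]
  exact congrArg (fun k : (adjToCmd.comp cmdToAdj).obj X ⟶ (adjToCmd.comp cmdToAdj).obj X =>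
    comparison X ≫ k) (comparison_em (adjToCmd.obj X))

/-- The bireflection of comonads into adjunctions and left loose morphisms. -/
def cmdAdj : Bireflection Cmd.{v, u} AdjLoose.{v, u} where
  R := cmdToAdj
  L := adjToCmd
  unit := mkStrongTrans _ _ (fun X => AdjLoose.comparison X)
    (fun f => AdjLoose.unitNat f)
    (fun {X Y f g} a => AdjLoose.hom_ext
      ((Category.comp_id _).trans (Category.id_comp _).symm) (by
        ext A
        exact Comonad.Coalgebra.Hom.ext (AdjLoose.Hom₂.comm a A).symm))
    (fun X => AdjLoose.isIdentity_mk (AdjLoose.unitNat_id X) _ (fun A => HEq.rfl) fun A =>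
      coalgebra_hom_heq rfl
        (congrArg (fun k => (AdjLoose.Hom.G k).obj A) (AdjLoose.unitNat_id X)).symm _ _ HEq.rfl)
    (fun f g => ⟨_, _, _, AdjLoose.eq_eqToHom_comp₂ (Strict.assoc f g _)
      (Strict.assoc f _ ((adjToCmd.comp cmdToAdj).map g)).symm (AdjLoose.unitNat_comp f g) _ _ _
      (fun A => heq_of_eq (by
        change 𝟙 _ = 𝟙 _ ≫ eqToHom _ ≫ (AdjLoose.Hom.F g).map (𝟙 _)
        simp)) fun A => coalgebra_hom_heq rfl
        (congrArg (fun k => (AdjLoose.Hom.G k).obj A) (AdjLoose.unitNat_comp f g)).symm _ _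
        (heq_of_eq (congrArg (fun k => Comonad.Coalgebra.Hom.f
          ((AdjLoose.ζHat g).hom.app ((AdjLoose.Hom.G f).obj A) ≫ k))
            (Category.id_comp ((Cmd.coalg (AdjLoose.homToCmd g)).map
              ((AdjLoose.ζHat f).hom.app A)))).symm)⟩)
  counit := cmdToAdj_adjToCmd
  left_triangle X := ⟨rfl, AdjLoose.left_triangle X⟩
  left_triangle₂ f := Cmd.isIdentity_mk (AdjLoose.left_triangle_naturality f) _ fun A => HEq.rfl
  right_triangle Z := ⟨rfl, AdjLoose.comparison_em Z⟩
  right_triangle₂ h := AdjLoose.isIdentity_mk (AdjLoose.unit_naturality_em h) _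
    (fun A => HEq.rfl) fun A => coalgebra_hom_heq rfl
      (congrArg (fun k => (AdjLoose.Hom.G k).obj A) (AdjLoose.unit_naturality_em h)).symm _ _
      HEq.rfl
  swallowtail X := AdjLoose.isIdentity_mk (AdjLoose.unit_naturality_comparison X) _
    (fun A => HEq.rfl) fun A => coalgebra_hom_heq rfl
      (congrArg (fun k => (AdjLoose.Hom.G k).obj A) (AdjLoose.unit_naturality_comparison X)).symm
      _ _ HEq.rfl

section Identities

variable {C D E : Type*} [Category C] [Category D] [Category E]

lemma IsIdentity.comp {X Y Z : C} {f : X ⟶ Y} {g : Y ⟶ Z} (hf : IsIdentity f)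
    (hg : IsIdentity g) : IsIdentity (f ≫ g) := by
  obtain ⟨rfl, rfl⟩ := hf
  simpa using hg

lemma IsIdentity.map {X Y : C} {f : X ⟶ Y} (hf : IsIdentity f) (F : C ⥤ D) :
    IsIdentity (F.map f) := by
  obtain ⟨rfl, rfl⟩ := hf
  exact ⟨rfl, by simp⟩

lemma IsIdentity.app {F G : C ⥤ D} {a : F ⟶ G} (ha : IsIdentity a) (X : C) :
    IsIdentity (a.app X) := by
  obtain ⟨rfl, rfl⟩ := ha
  exact ⟨rfl, rfl⟩

lemma isIdentity_natTrans {F G : C ⥤ D} {a : F ⟶ G} (h : F = G) (ha : ∀ X, IsIdentity (a.app X)) :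
    IsIdentity a := by
  subst h
  refine ⟨rfl, ?_⟩
  ext X
  exact (ha X).choose_spec

end Identities

section Classes

variable {B : Type u₁} [Bicategory.{w₁, v₁} B] {C : Type u₂} [Bicategory.{w₂, v₂} C]

namespace OneCellClass

/-- Inverse image of a class of 1-cells. -/
def comap (F : StrictPseudofunctor B C) (W : OneCellClass C) : OneCellClass B where
  P f := W.P (F.map f)
  id_mem X := by rw [F.map_id]; exact W.id_mem _
  comp_mem f g hf hg := by rw [F.map_comp]; exact W.comp_mem _ _ hf hg

/-- Intersection of two classes of 1-cells. -/
def inter (W W' : OneCellClass B) : OneCellClass B where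
  P f := W.P f ∧ W'.P f
  id_mem X := ⟨W.id_mem X, W'.id_mem X⟩
  comp_mem f g hf hg := ⟨W.comp_mem f g hf.1 hg.1, W'.comp_mem f g hf.2 hg.2⟩

end OneCellClass

end Classes

/-- Pseudo morphisms of comonads: `θ` is invertible. -/
def Cmd.pseudo : OneCellClass Cmd.{v, u} where
  P f := IsIso (Hom.θ f)
  id_mem X := by
    rw [NatTrans.isIso_iff_isIso_app]
    intro A
    exact IsIso.id (X.K.obj A)
  comp_mem {X Y Z} f g hf hg := by
    rw [NatTrans.isIso_iff_isIso_app] at *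
    intro A
    have := hf A
    have := hg ((Hom.H f).obj A)
    exact inferInstanceAs (IsIso ((Hom.H g).map ((Hom.θ f).app A) ≫ (Hom.θ g).app _))

/-- Strict morphisms of comonads: `θ` is an identity. -/
def Cmd.strict : OneCellClass Cmd.{v, u} where
  P f := IsIdentity (Hom.θ f)
  id_mem X := ⟨rfl, rfl⟩
  comp_mem {X Y Z} f g hf hg := by
    obtain ⟨h₁, -⟩ := id hf
    obtain ⟨h₂, -⟩ := id hg
    refine isIdentity_natTrans ?_ fun A => ((hf.app A).map _).comp (hg.app _)
    change (X.K.toFunctor ⋙ Hom.H f) ⋙ Hom.H g = Hom.H f ⋙ (Hom.H g ⋙ Z.K.toFunctor)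
    rw [h₁, ← h₂]; rfl

namespace AdjLoose

/-- Left morphisms of adjunctions: `ζ` is an identity. -/
def left : OneCellClass AdjLoose.{v, u} where
  P f := IsIdentity (Hom.ζ f).hom
  id_mem X := ⟨rfl, rfl⟩
  comp_mem {X Y Z} f g hf hg := by
    obtain ⟨h₁, -⟩ := id hf
    obtain ⟨h₂, -⟩ := id hg
    refine isIdentity_natTrans ?_ fun A => (hg.app _).comp ((hf.app A).map _)
    change Hom.G f ⋙ (Hom.G g ⋙ Z.L) = (X.L ⋙ Hom.F f) ⋙ Hom.F g
    rw [h₂, ← h₁]; rfl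

lemma mate_id (X : AdjLoose.{v, u}) (A : X.C) : (mate (Hom.id X)).app A = 𝟙 _ := by
  simp

/-- Pseudo left loose morphisms: the mate of `ζ` is invertible. -/
def pseudo : OneCellClass AdjLoose.{v, u} where
  P f := IsIso (mate f)
  id_mem X := by
    rw [NatTrans.isIso_iff_isIso_app]
    intro A
    rw [show (mate (𝟙 X)).app A = 𝟙 (X.R.obj A) from mate_id X A]
    exact IsIso.id _
  comp_mem {X Y Z} f g hf hg := by
    rw [NatTrans.isIso_iff_isIso_app] at *
    intro A
    have := hf A
    have := hg ((Hom.F f).obj A)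
    rw [show (mate (f ≫ g)).app A = _ from mate_comp f g A]
    infer_instance

/-- Strict left loose morphisms: the mate of `ζ` is an identity. -/
def strict : OneCellClass AdjLoose.{v, u} where
  P f := IsIdentity (mate f)
  id_mem X := isIdentity_natTrans rfl fun A => ⟨rfl, mate_id X A⟩
  comp_mem {X Y Z} f g hf hg := by
    obtain ⟨h₁, -⟩ := id hf
    obtain ⟨h₂, -⟩ := id hg
    refine isIdentity_natTrans ?_ fun A => ?_
    · change (X.R ⋙ Hom.G f) ⋙ Hom.G g = Hom.F f ⋙ (Hom.F g ⋙ Z.R)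
      rw [h₁, ← h₂]; rfl
    · rw [show (mate (f ≫ g)).app A = _ from mate_comp f g A]
      exact ((hf.app A).map _).comp (hg.app _)

end AdjLoose

/-- The forgetful 2-functor to comonads. -/
def WCCmd.forgetCmd : StrictPseudofunctor WCCmd.{v, u} Cmd.{v, u} :=
  StrictPseudofunctor.mk''
    { obj X := X.toCmd
      map f := Hom.toCmd f
      map₂ a := Hom₂.toCmd a
      map₂_id _ := rfl
      map₂_comp _ _ := rfl
      map_id _ := rfl
      map_comp _ _ := rfl
      map₂_whisker_left _ _ _ _ := by simp; rfl
      map₂_whisker_right _ _ := by simp; rfl }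

/-- The forgetful 2-functor to fibrations. -/
def WCCmd.forgetFib : StrictPseudofunctor WCCmd.{v, u} Fib.{v, u} :=
  StrictPseudofunctor.mk''
    { obj X := X.fib
      map f := Hom.fib f
      map₂ a := Hom₂.fib a
      map₂_id _ := rfl
      map₂_comp _ _ := rfl
      map_id _ := rfl
      map_comp _ _ := rfl
      map₂_whisker_left _ _ _ _ := by simp; rfl
      map₂_whisker_right _ _ := by simp; rfl }

/-- The forgetful 2-functor to adjunctions. -/
def GCwfLoose.forgetAdj : StrictPseudofunctor GCwfLoose.{v, u} AdjLoose.{v, u} :=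
  StrictPseudofunctor.mk''
    { obj X := X.toAdj
      map f := Hom.toAdj f
      map₂ a := Hom₂.toAdj a
      map₂_id _ := rfl
      map₂_comp _ _ := rfl
      map_id _ := rfl
      map_comp _ _ := rfl
      map₂_whisker_left _ _ _ _ := by simp; rfl
      map₂_whisker_right _ _ := by simp; rfl }

/-- The forgetful 2-functor to fibrations, which retains the fibration of types. -/
def GCwfLoose.forgetFib : StrictPseudofunctor GCwfLoose.{v, u} Fib.{v, u} :=
  StrictPseudofunctor.mk''
    { obj X := X.types
      map f := Hom.types f
      map₂ a := Hom₂.types a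
      map₂_id _ := rfl
      map₂_comp _ _ := rfl
      map_id _ := rfl
      map_comp _ _ := rfl
      map₂_whisker_left _ _ _ _ := by simp; rfl
      map₂_whisker_right _ _ := by simp; rfl }

/-- The 2-category of adjunctions and left morphisms. -/
abbrev AdjLeft : Type (max u v + 1) := WideSub AdjLoose.left.{v, u}

/-- The 2-reflection of comonads into adjunctions and left morphisms. -/
def cmdAdjLeft : Bireflection Cmd.{v, u} AdjLeft.{v, u} :=
  cmdAdj.restrictRight AdjLoose.left (fun _ => ⟨rfl, rfl⟩) (fun _ => ⟨rfl, rfl⟩)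

/-- Pseudo morphisms of weakening and contraction comonads. -/
def WCCmd.pseudo : OneCellClass WCCmd.{v, u} := Cmd.pseudo.comap WCCmd.forgetCmd

/-- Strict morphisms of weakening and contraction comonads. -/
def WCCmd.strict : OneCellClass WCCmd.{v, u} := Cmd.strict.comap WCCmd.forgetCmd

/-- The (lax, non-loose) morphisms of gcwfs: the loose morphisms with `ζ` an identity. -/
def GCwfLoose.left : OneCellClass GCwfLoose.{v, u} := AdjLoose.left.comap GCwfLoose.forgetAdj

/-- Pseudo loose morphisms of gcwfs: the mate of `ζ` is invertible. -/
def GCwfLoose.pseudo : OneCellClass GCwfLoose.{v, u} := AdjLoose.pseudo.comap GCwfLoose.forgetAdj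

/-- Strict loose morphisms of gcwfs: the mate of `ζ` is an identity. -/
def GCwfLoose.strict : OneCellClass GCwfLoose.{v, u} := AdjLoose.strict.comap GCwfLoose.forgetAdj

/-- The 2-category of weakening and contraction comonads and pseudo morphisms. -/
abbrev WCCmdPs : Type (max u v + 1) := WideSub WCCmd.pseudo.{v, u}

/-- The 2-category of weakening and contraction comonads and strict morphisms. -/
abbrev WCCmdStr : Type (max u v + 1) := WideSub WCCmd.strict.{v, u}

/-- The 2-category of gcwfs and pseudo loose morphisms. -/
abbrev GCwfLoosePs : Type (max u v + 1) := WideSub GCwfLoose.pseudo.{v, u}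

/-- The 2-category of gcwfs and gcwf morphisms. -/
abbrev GCwf : Type (max u v + 1) := WideSub GCwfLoose.left.{v, u}

/-- The 2-category of gcwfs and pseudo gcwf morphisms. -/
abbrev GCwfPs : Type (max u v + 1) := WideSub (GCwfLoose.left.{v, u}.inter GCwfLoose.pseudo)

/-- The 2-category of gcwfs and strict gcwf morphisms. -/
abbrev GCwfStr : Type (max u v + 1) := WideSub (GCwfLoose.left.{v, u}.inter GCwfLoose.strict)

/-- The forgetful 2-functor from gcwfs and gcwf morphisms to adjunctions and left morphisms. -/
def GCwf.forgetAdj : StrictPseudofunctor GCwf.{v, u} AdjLeft.{v, u} :=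
  WideSub.restrict GCwfLoose.forgetAdj GCwfLoose.left AdjLoose.left fun _ h => h

/-- The inclusion of pseudo gcwf morphisms. -/
def GCwfPs.incl : StrictPseudofunctor GCwfPs.{v, u} GCwf.{v, u} :=
  WideSub.inclOfLE fun _ h => h.1

/-- The inclusion of strict gcwf morphisms. -/
def GCwfStr.incl : StrictPseudofunctor GCwfStr.{v, u} GCwf.{v, u} :=
  WideSub.inclOfLE fun _ h => h.1

end WCC

/-!
The bireflection between comonads and adjunctions (the Eilenberg–Moore adjunction of a comonad, the
comonad of an adjunction, and the comparison functors) lifts to weakening and contraction comonads and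
generalised categories with families because the additional fibrational structure is transported by
each of its ingredients.

From comonads to gcwfs: if `K` is a weakening and contraction comonad on `p : E ⥤ B`, then coalgebras
are fibred over `B` by `K.forget ⋙ p`, and an arrow of coalgebras is cartesian if and only if its
underlying arrow is (`WCCmd.coalgProj_isFibered`, `WCCmd.isCart_coalgProj_iff`). The point is that
arrows into `K A` are determined by their composites with `ε_A` and `K f`, for any cartesian
`f : A ⟶ A'`, by the pullback condition (`WCCmd.hom_ext_of_isCart`); so a cartesian arrow into the
carrier of a coalgebra lifts to coalgebras (`WCCmd.exists_coalgebra`).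

From gcwfs to comonads: that naturality squares of the counit of `Σ ⊣ Δ` at cartesian arrows lie over
pullbacks follows from the existence of cartesian lifts of terms (`isPullback_counit`).

The comparison functor from the terms of a gcwf to coalgebras is fully faithful, because the
components of the unit are cartesian, and every coalgebra `a : A ⟶ Σ Δ A` is vertically isomorphic to
one in its image: `a` is cartesian, being a section of the cartesian arrow `ε_A`, and therefore agrees
with the image under `Σ` of a cartesian lift of `p a` with codomain `Δ A` (`GCwfLoose.exists_term`).
The resulting pseudo-inverse commutes strictly with the functors to the base, which makes the
comparison an equivalence in the 2-category of gcwfs and loose morphisms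
(`wcCmdGCwf_isBiequivalence`).

All equations between 1-cells and between 2-cells are those of the bireflection of comonads into
adjunctions together with trivial ones between morphisms of fibrations. As to the restrictions, the
naturality 2-cell of the unit at a gcwf morphism has identities as components
(`GCwfLoose.isIdentity_unitNat`). The component at `A` of the mate of the morphism of Eilenberg–Moore
adjunctions induced by `(H, θ)` has the underlying arrow `θ_A` (`Cmd.mate_emHom`), so that pseudo and
strict morphisms correspond to each other; the mates of the comparison morphisms are identities, and
hence their inverses are pseudo by cancellation (`GCwfLoose.pseudo_comparisonInv`).
-/

namespace WCC

/-! ### Cartesian arrows -/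

section Cartesian

variable {B E T : Type*} [Category B] [Category E] [Category T]

lemma isHomLift_comp_iff {S : T ⥤ E} {p : E ⥤ B} {X Y : B} {f : X ⟶ Y} {a b : T} {k : a ⟶ b} :
    (S ⋙ p).IsHomLift f k ↔ p.IsHomLift f (S.map k) := by
  constructor
  · intro h
    cases h
    exact IsHomLift.map p (S.map k)
  · intro h
    have h₁ := IsHomLift.domain_eq p f (S.map k)
    have h₂ := IsHomLift.codomain_eq p f (S.map k)
    exact IsHomLift.of_fac' _ _ _ h₁ h₂ (IsHomLift.fac' p f (S.map k))

lemma map_eq_of_isHomLift {p : E ⥤ B} {a b : E} {f : p.obj a ⟶ p.obj b} {k : a ⟶ b}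
    (h : p.IsHomLift f k) : p.map k = f :=
  (IsHomLift.eq_of_isHomLift p f k).symm

/-- The universal property of a cartesian arrow, with equations in place of the predicate
`IsHomLift`. -/
lemma isCart_iff {p : E ⥤ B} {a b : E} {f : a ⟶ b} : IsCart p f ↔
    ∀ (c : E) (g : p.obj c ⟶ p.obj a) (h : c ⟶ b), p.map h = g ≫ p.map f →
      ∃! k : c ⟶ a, p.map k = g ∧ k ≫ f = h := by
  constructor
  · intro hf c g h e
    obtain ⟨k, ⟨hk, hk'⟩, hu⟩ :=
      Functor.IsStronglyCartesian.universal_property p (p.map f) f g (p.map h) e h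
    refine ⟨k, ⟨map_eq_of_isHomLift hk, hk'⟩, ?_⟩
    rintro l ⟨rfl, hl⟩
    exact hu l ⟨inferInstance, hl⟩
  · intro H
    refine { universal_property' := fun {c} g h hh => ?_ }
    obtain ⟨k, ⟨rfl, hk'⟩, hu⟩ := H c g h (map_eq_of_isHomLift hh)
    exact ⟨k, ⟨inferInstance, hk'⟩, fun l hl => hu l ⟨map_eq_of_isHomLift hl.1, hl.2⟩⟩

lemma IsCart.exists_lift {p : E ⥤ B} {a b : E} {f : a ⟶ b} (hf : IsCart p f) {c : E}
    (g : p.obj c ⟶ p.obj a) (h : c ⟶ b) (e : p.map h = g ≫ p.map f) :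
    ∃ k : c ⟶ a, p.map k = g ∧ k ≫ f = h :=
  (isCart_iff.1 hf c g h e).exists

lemma IsCart.hom_ext {p : E ⥤ B} {a b : E} {f : a ⟶ b} (hf : IsCart p f) {c : E}
    {k l : c ⟶ a} (h : p.map k = p.map l) (h' : k ≫ f = l ≫ f) : k = l :=
  (isCart_iff.1 hf c (p.map l) (l ≫ f) (p.map_comp _ _)).unique ⟨h, h'⟩ ⟨rfl, rfl⟩

lemma IsCart.comp {p : E ⥤ B} {a b c : E} {f : a ⟶ b} {g : b ⟶ c} (hf : IsCart p f)
    (hg : IsCart p g) : IsCart p (f ≫ g) := by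
  unfold IsCart at *
  rw [p.map_comp]
  infer_instance

lemma IsCart.of_comp {p : E ⥤ B} {a b c : E} {f : a ⟶ b} {g : b ⟶ c} (hg : IsCart p g)
    (hfg : IsCart p (f ≫ g)) : IsCart p f := by
  unfold IsCart at *
  rw [p.map_comp] at hfg
  exact Functor.IsStronglyCartesian.of_comp (p := p) (f := p.map f) (g := p.map g) (ψ := g)

lemma isCart_of_isIso (p : E ⥤ B) {a b : E} (f : a ⟶ b) [IsIso f] : IsCart p f :=
  inferInstanceAs (p.IsStronglyCartesian (p.map f) f)

lemma exists_isCart (p : E ⥤ B) [p.IsFibered] {b : E} {X : B} (s : X ⟶ p.obj b) :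
    ∃ (a : E) (f : a ⟶ b), p.IsHomLift s f ∧ IsCart p f := by
  obtain ⟨a, f, hf⟩ := Functor.IsPreFibered.exists_isCartesian' (p := p) s
  obtain rfl := IsHomLift.domain_eq p s f
  obtain rfl := map_eq_of_isHomLift hf.toIsHomLift
  exact ⟨a, f, inferInstance, inferInstance⟩

lemma isFibered_of_exists_isCart (p : E ⥤ B)
    (h : ∀ (b : E) (X : B) (s : X ⟶ p.obj b), ∃ (a : E) (f : a ⟶ b), p.IsHomLift s f ∧ IsCart p f) :
    p.IsFibered :=
  .of_exists_isStronglyCartesian fun b X s => by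
    obtain ⟨a, f, hf, hc⟩ := h b X s
    obtain rfl := IsHomLift.domain_eq p s f
    obtain rfl := map_eq_of_isHomLift hf
    exact ⟨a, f, hc⟩

lemma IsCart.isStronglyCartesian {p : E ⥤ B} {a b : E} {f : a ⟶ b} (hf : IsCart p f) {X Y : B}
    {s : X ⟶ Y} (h : p.IsHomLift s f) : p.IsStronglyCartesian s f := by
  cases h
  exact hf

/-- Two cartesian arrows over the same arrow differ by a vertical isomorphism of the domains. -/
lemma IsCart.exists_iso {p : E ⥤ B} {a a' b : E} {f : a ⟶ b} {f' : a' ⟶ b} (hf : IsCart p f)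
    (hf' : IsCart p f') (h : p.IsHomLift (p.map f) f') :
    ∃ e : a' ≅ a, p.IsHomLift (𝟙 (p.obj a)) e.hom ∧ e.hom ≫ f = f' := by
  have := hf'.isStronglyCartesian h
  exact ⟨Functor.IsCartesian.domainUniqueUpToIso p (p.map f) f f', inferInstance,
    Functor.IsCartesian.fac p (p.map f) f f'⟩

/-- A fully faithful functor over the base reflects cartesian arrows. -/
lemma isCart_of_map {p : E ⥤ B} {S : T ⥤ E} [S.Full] [S.Faithful] {a b : T} {f : a ⟶ b}
    (hf : IsCart p (S.map f)) : IsCart (S ⋙ p) f := by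
  refine isCart_iff.2 fun c g h e => ?_
  obtain ⟨k, hk, hk'⟩ := hf.exists_lift (c := S.obj c) g (S.map h) e
  obtain ⟨k, rfl⟩ := S.map_surjective k
  refine ⟨k, ⟨hk, S.map_injective (by simpa using hk')⟩, ?_⟩
  rintro l ⟨hl, rfl⟩
  exact S.map_injective (hf.hom_ext (hl.trans hk.symm) (by simpa using hk'.symm))

/-- If `S ⊣ D` and `S ⋙ p` is a fibration, then the naturality squares of the counit at cartesian
arrows lie over pullbacks. To fill a cone with vertex `X`, take a cartesian lift `Z ⟶ D A'` of its
leg into `p (S (D A'))`: the other leg then lifts to an arrow `S Z ⟶ A`, and the filler is the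
image of the transpose `Z ⟶ D A`. -/
lemma isPullback_counit {p : E ⥤ B} {S : T ⥤ E} {D : E ⥤ T} (adj : S ⊣ D) [(S ⋙ p).IsFibered]
    {A A' : E} {f : A ⟶ A'} (hf : IsCart p f) :
    IsPullback (p.map (adj.counit.app A)) (p.map (S.map (D.map f))) (p.map f)
      (p.map (adj.counit.app A')) := by
  have key : ∀ (X : B) (x : X ⟶ p.obj A) (y : X ⟶ p.obj (S.obj (D.obj A'))),
      x ≫ p.map f = y ≫ p.map (adj.counit.app A') →
      ∃! t : X ⟶ p.obj (S.obj (D.obj A)),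
        t ≫ p.map (adj.counit.app A) = x ∧ t ≫ p.map (S.map (D.map f)) = y := by
    intro X x y hxy
    obtain ⟨Z, g, hg, hgc⟩ := exists_isCart (S ⋙ p) (b := D.obj A') y
    obtain rfl := IsHomLift.domain_eq (S ⋙ p) y g
    obtain rfl := map_eq_of_isHomLift hg
    obtain ⟨h, rfl, hh⟩ := hf.exists_lift (c := S.obj Z) x (S.map g ≫ adj.counit.app A')
      ((p.map_comp _ _).trans hxy.symm)
    have hg' : adj.homEquiv _ _ h ≫ D.map f = g := by
      rw [← adj.homEquiv_naturality_right, hh, ← Equiv.eq_symm_apply, adj.homEquiv_counit]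
    refine ⟨p.map (S.map (adj.homEquiv _ _ h)), ⟨?_, ?_⟩, ?_⟩
    · rw [← p.map_comp, ← adj.homEquiv_counit (g := adj.homEquiv _ _ h),
        Equiv.symm_apply_apply]
    · rw [← p.map_comp, ← S.map_comp, hg', Functor.comp_map]
    · rintro t ⟨ht₁, ht₂⟩
      -- Compare with a cartesian lift of the given filler.
      obtain ⟨Z', g', hg'l, hgc'⟩ := exists_isCart (S ⋙ p) (b := D.obj A) t
      have hZ := IsHomLift.domain_eq (S ⋙ p) t g'
      have ht := IsHomLift.fac' (S ⋙ p) t g'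
      simp only [eqToHom_refl, Category.comp_id] at ht
      obtain ⟨w, hw, hw'⟩ := hgc.exists_lift (eqToHom hZ) (g' ≫ D.map f) (by
        rw [Functor.map_comp, ht, ← ht₂, Category.assoc]; rfl)
      have h1 : S.map w ≫ h = S.map g' ≫ adj.counit.app A := by
        refine hf.hom_ext ?_ ?_
        · rw [p.map_comp, p.map_comp]
          rw [Functor.comp_map] at hw ht
          rw [hw, ht, Category.assoc, ht₁]
        · rw [Category.assoc, hh, ← S.map_comp_assoc, hw']
          simp
      have h2 : w ≫ adj.homEquiv _ _ h = g' := by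
        rw [← adj.homEquiv_naturality_left, h1, ← Equiv.eq_symm_apply, adj.homEquiv_counit]
      have h3 := congrArg (S ⋙ p).map h2
      rw [ht, Functor.map_comp, hw, cancel_epi] at h3
      exact h3.symm
  choose l hl hu using key
  exact ⟨⟨by rw [← p.map_comp, ← p.map_comp]; congr 1; exact (adj.counit.naturality f).symm⟩,
    ⟨Limits.PullbackCone.IsLimit.mk _ (fun s => l _ s.fst s.snd s.condition)
      (fun s => (hl _ _ _ s.condition).1) (fun s => (hl _ _ _ s.condition).2)
      fun s m h h' => hu _ _ _ s.condition m ⟨h, h'⟩⟩⟩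

end Cartesian

/-! ### Coalgebras for a weakening and contraction comonad -/

namespace WCCmd

variable (X : WCCmd.{v, u})

lemma map_isCart {A B : X.fib.E} {f : A ⟶ B} (hf : IsCart X.fib.p f) :
    IsCart X.fib.p (X.K.map f) := by
  refine IsCart.of_comp (X.counit_cart B) ?_
  have h := X.K.ε.naturality f
  dsimp at h
  rw [h]
  exact (X.counit_cart A).comp hf

/-- Arrows into `K A` are determined by their composites with the counit and with `K f`, for any
cartesian `f`: the pullback condition determines the arrow of the base, and the counit, being
cartesian, the arrow itself. -/
lemma hom_ext_of_isCart {A B C : X.fib.E} {f : A ⟶ B} (hf : IsCart X.fib.p f)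
    {k l : C ⟶ X.K.obj A} (h : k ≫ X.K.ε.app A = l ≫ X.K.ε.app A)
    (h' : k ≫ X.K.map f = l ≫ X.K.map f) : k = l := by
  refine (X.counit_cart A).hom_ext ((X.isPullback f hf).hom_ext ?_ ?_) h
  · rw [← Functor.map_comp, ← Functor.map_comp, h]
  · rw [← Functor.map_comp, ← Functor.map_comp, h']

/-- The structure map of a coalgebra is cartesian, being a section of a cartesian arrow. -/
lemma a_isCart (A : X.K.Coalgebra) : IsCart X.fib.p A.a := by
  refine IsCart.of_comp (X.counit_cart A.A) ?_
  rw [A.counit]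
  exact isCart_of_isIso _ _

/-- The functor from coalgebras to the base of the fibration. -/
abbrev coalgProj : X.K.Coalgebra ⥤ X.fib.B := X.K.forget ⋙ X.fib.p

/-- A cartesian arrow into the carrier of a coalgebra lifts to coalgebras: the structure map on its
domain is the section of the counit over the arrow into the pullback `p (K A)` that is induced by the
identity and by the structure map of the codomain. -/
lemma exists_coalgebra (B : X.K.Coalgebra) {A : X.fib.E} (f : A ⟶ B.A) (hf : IsCart X.fib.p f) :
    ∃ a : A ⟶ X.K.obj A, a ≫ X.K.ε.app A = 𝟙 A ∧ a ≫ X.K.δ.app A = a ≫ X.K.map a ∧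
      a ≫ X.K.map f = f ≫ B.a := by
  have hpb := X.isPullback f hf
  have e : 𝟙 (X.fib.p.obj A) ≫ X.fib.p.map f =
      X.fib.p.map (f ≫ B.a) ≫ X.fib.p.map (X.K.ε.app B.A) := by
    rw [← Functor.map_comp, Category.assoc, B.counit, Category.comp_id, Category.id_comp]
  obtain ⟨a, ha, ha'⟩ := (X.counit_cart A).exists_lift (hpb.lift _ _ e) (𝟙 A) (by
    rw [hpb.lift_fst, CategoryTheory.Functor.map_id])
  have hnat : X.K.map f ≫ X.K.ε.app B.A = X.K.ε.app A ≫ f := X.K.ε.naturality f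
  have hf' : a ≫ X.K.map f = f ≫ B.a := by
    refine (X.counit_cart B.A).hom_ext ?_ ?_
    · rw [Functor.map_comp, ha, hpb.lift_snd]
    · rw [Category.assoc, Category.assoc, B.counit, hnat, reassoc_of% ha', Category.comp_id]
  refine ⟨a, ha', ?_, hf'⟩
  -- Coassociativity is an equation between arrows into `K (K A)`, to be tested against `K (K f)`.
  refine X.hom_ext_of_isCart (X.map_isCart hf) ?_ ?_
  · have h := X.K.ε.naturality a
    dsimp at h
    rw [Category.assoc, X.K.left_counit, Category.assoc, h, reassoc_of% ha', Category.comp_id]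
  · have h := X.K.δ.naturality f
    dsimp at h
    rw [Category.assoc, ← h, reassoc_of% hf', B.coassoc, Category.assoc, ← Functor.map_comp, hf',
      Functor.map_comp, reassoc_of% hf']

lemma isCart_of_isCart_f {A B : X.K.Coalgebra} {f : A ⟶ B} (hf : IsCart X.fib.p f.f) :
    IsCart X.coalgProj f := by
  refine isCart_iff.2 fun C g h e => ?_
  obtain ⟨k, hk, hk'⟩ := hf.exists_lift (c := C.A) g h.f e
  refine ⟨⟨k, ?_⟩, ⟨hk, Comonad.Coalgebra.Hom.ext hk'⟩, ?_⟩
  · refine X.hom_ext_of_isCart hf ?_ ?_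
    · have h := X.K.ε.naturality k
      dsimp at h
      rw [Category.assoc, h, reassoc_of% C.counit, Category.assoc, A.counit, Category.comp_id]
    · rw [Category.assoc, ← Functor.map_comp, hk', Category.assoc, f.h, reassoc_of% hk', h.h]
  · rintro l ⟨hl, rfl⟩
    exact Comonad.Coalgebra.Hom.ext (hf.hom_ext (hl.trans hk.symm) hk'.symm)

lemma exists_isCart_f (B : X.K.Coalgebra) {Y : X.fib.B} (s : Y ⟶ X.fib.p.obj B.A) :
    ∃ (A : X.K.Coalgebra) (f : A ⟶ B), X.coalgProj.IsHomLift s f ∧ IsCart X.fib.p f.f := by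
  have := X.fib.isFibered
  obtain ⟨A, f, hf, hc⟩ := exists_isCart X.fib.p s
  obtain ⟨a, h₁, h₂, h₃⟩ := X.exists_coalgebra B f hc
  exact ⟨⟨A, a, h₁, h₂⟩, ⟨f, h₃⟩, (isHomLift_comp_iff (S := X.K.forget)).2 hf, hc⟩

lemma coalgProj_isFibered : X.coalgProj.IsFibered :=
  isFibered_of_exists_isCart _ fun B Y s => by
    obtain ⟨A, f, hf, hc⟩ := X.exists_isCart_f B s
    exact ⟨A, f, hf, X.isCart_of_isCart_f hc⟩

/-- An arrow of coalgebras is cartesian if and only if the underlying arrow is. -/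
lemma isCart_coalgProj_iff {A B : X.K.Coalgebra} {f : A ⟶ B} :
    IsCart X.coalgProj f ↔ IsCart X.fib.p f.f := by
  refine ⟨fun hf => ?_, X.isCart_of_isCart_f⟩
  obtain ⟨A', f', hl, hc⟩ := X.exists_isCart_f B (X.coalgProj.map f)
  obtain ⟨e, -, he⟩ := IsCart.exists_iso hf (X.isCart_of_isCart_f hc) hl
  rw [← Iso.eq_inv_comp] at he
  rw [he]
  have : IsIso e.inv.f := inferInstanceAs (IsIso (X.K.forget.map e.inv))
  exact (isCart_of_isIso X.fib.p e.inv.f).comp hc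

end WCCmd

/-! ### The comparison functor of a generalised category with families -/

namespace GCwfLoose

variable (X : GCwfLoose.{v, u})

lemma isFibered_S_comp : (X.S ⋙ X.types.p).IsFibered :=
  X.S_comp ▸ X.du_isFibered

lemma isHomLift_du_iff {Y Z : X.types.B} {f : Y ⟶ Z} {a b : X.T} {k : a ⟶ b} :
    X.du.IsHomLift f k ↔ X.types.p.IsHomLift f (X.S.map k) := by
  rw [← isHomLift_comp_iff, X.S_comp]

lemma isCart_du_iff {a b : X.T} {f : a ⟶ b} :
    IsCart X.du f ↔ IsCart (X.S ⋙ X.types.p) f := by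
  rw [X.S_comp]

/-- The weakening and contraction comonad of a generalised category with families. -/
@[reducible]
def toWCCmd : WCCmd.{v, u} where
  fib := X.types
  K := X.adj.toComonad
  counit_cart := X.counit_cart
  isPullback f hf := by
    have := X.isFibered_S_comp
    exact isPullback_counit X.adj hf

/-- The comparison functor from terms to coalgebras. -/
abbrev toCoalg : X.T ⥤ X.adj.toComonad.Coalgebra := Comonad.comparison X.adj

/-- The functor from coalgebras to the base. -/
abbrev coalgProj : X.adj.toComonad.Coalgebra ⥤ X.types.B := X.adj.toComonad.forget ⋙ X.types.p

/-- The functor `S` is faithful, because the components of the unit are cartesian. -/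
lemma hom_ext_of_map_S {a b : X.T} {k l : a ⟶ b} (h : X.S.map k = X.S.map l) : k = l := by
  have hb := X.isCart_du_iff.1 (X.unit_cart b)
  refine hb.hom_ext (congrArg X.types.p.map h) ?_
  have hk := X.adj.unit.naturality k
  have hl := X.adj.unit.naturality l
  dsimp at hk hl
  rw [hk, hl, h]

instance : X.toCoalg.Faithful where
  map_injective h := X.hom_ext_of_map_S (congrArg Comonad.Coalgebra.Hom.f h)

/-- An arrow `f : S a ⟶ S b` of coalgebras is the image of the lift of `D f ∘ η_a` through the
cartesian arrow `η_b`. -/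
instance : X.toCoalg.Full where
  map_surjective {a b} h := by
    have hb := X.isCart_du_iff.1 (X.unit_cart b)
    obtain ⟨f, hf⟩ := h
    change X.S.obj a ⟶ X.S.obj b at f
    have hh : X.S.map (X.adj.unit.app a) ≫ X.S.map (X.D.map f) =
      f ≫ X.S.map (X.adj.unit.app b) := hf
    obtain ⟨k, -, hk⟩ := hb.exists_lift (X.types.p.map f) (X.adj.unit.app a ≫ X.D.map f) (by
      rw [Functor.comp_map, Functor.comp_map, ← X.types.p.map_comp, ← hh, ← X.S.map_comp])
    refine ⟨k, Comonad.Coalgebra.Hom.ext ?_⟩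
    change X.S.map k = f
    -- The image under `S` of the unit is a split monomorphism.
    have h₁ : X.S.map k ≫ X.S.map (X.adj.unit.app b) = f ≫ X.S.map (X.adj.unit.app b) := by
      rw [← hh, ← X.S.map_comp, ← X.S.map_comp]
      exact congrArg X.S.map hk
    have h₂ := X.adj.left_triangle_components b
    have h₃ := congrArg (· ≫ X.adj.counit.app (X.S.obj b)) h₁
    simpa [h₂] using h₃

lemma isCart_coalgProj_of_isCart {a b : X.T} {f : a ⟶ b} (hf : IsCart X.du f) :
    IsCart X.coalgProj (X.toCoalg.map f) :=
  X.toWCCmd.isCart_of_isCart_f (X.S_cart f hf)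

lemma isCart_of_isCart_coalgProj {a b : X.T} {f : a ⟶ b}
    (hf : IsCart X.coalgProj (X.toCoalg.map f)) : IsCart X.du f :=
  X.isCart_du_iff.2 (isCart_of_map (S := X.toCoalg) (p := X.coalgProj) hf)

/-- Every coalgebra is vertically isomorphic to the image of a term: take a cartesian lift of the
image in the base of the structure map `A ⟶ S (D A)`, which is itself cartesian. -/
lemma exists_term (A : X.adj.toComonad.Coalgebra) : ∃ (t : X.T) (e : X.toCoalg.obj t ≅ A),
    X.types.p.IsHomLift (𝟙 (X.types.p.obj A.A)) e.hom.f := by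
  have := X.isFibered_S_comp
  obtain ⟨t, n, hn, hc⟩ := exists_isCart (X.S ⋙ X.types.p) (b := X.D.obj A.A)
    (X.types.p.map A.a)
  obtain ⟨e, he, he'⟩ := IsCart.exists_iso (X.toWCCmd.a_isCart A)
    (X.S_cart n (X.isCart_du_iff.2 hc)) (isHomLift_comp_iff.1 hn)
  refine ⟨t, Comonad.Coalgebra.isoMk e ?_, he⟩
  have h₁ : X.adj.homEquiv _ _ e.hom = n := by
    rw [← Equiv.eq_symm_apply, X.adj.homEquiv_counit, ← he']
    exact ((Category.assoc _ _ _).trans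
      ((congrArg (e.hom ≫ ·) A.counit).trans (Category.comp_id e.hom))).symm
  rw [X.adj.homEquiv_unit] at h₁
  exact (X.S.map_comp _ _).symm.trans ((congrArg X.S.map h₁).trans he'.symm)

/-- A term with the given coalgebra, up to vertical isomorphism. -/
noncomputable def term (A : X.adj.toComonad.Coalgebra) : X.T := (X.exists_term A).choose

/-- The vertical isomorphism between the coalgebra of the chosen term and the given one. -/
noncomputable def termIso (A : X.adj.toComonad.Coalgebra) : X.toCoalg.obj (X.term A) ≅ A :=
  (X.exists_term A).choose_spec.choose

lemma termIso_vertical (A : X.adj.toComonad.Coalgebra) :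
    X.types.p.IsHomLift (𝟙 (X.types.p.obj A.A)) (X.termIso A).hom.f :=
  (X.exists_term A).choose_spec.choose_spec

lemma termIso_inv_vertical (A : X.adj.toComonad.Coalgebra) :
    X.types.p.IsHomLift (𝟙 (X.types.p.obj A.A)) (X.termIso A).inv.f := by
  have := X.termIso_vertical A
  have : X.types.p.IsHomLift (𝟙 (X.types.p.obj A.A))
    (X.adj.toComonad.forget.mapIso (X.termIso A)).hom := X.termIso_vertical A
  exact IsHomLift.lift_id_inv X.types.p _ (X.adj.toComonad.forget.mapIso (X.termIso A))

/-- The pseudo-inverse of the comparison functor that sends a coalgebra to the chosen term. It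
commutes strictly with the functors to the base. -/
@[reducible]
noncomputable def ofCoalg : X.adj.toComonad.Coalgebra ⥤ X.T where
  obj := X.term
  map {A B} f := X.toCoalg.preimage ((X.termIso A).hom ≫ f ≫ (X.termIso B).inv)
  map_id A := X.toCoalg.map_injective (by simp)
  map_comp f g := X.toCoalg.map_injective (by simp)

lemma toCoalg_map_ofCoalg_map {A B : X.adj.toComonad.Coalgebra} (f : A ⟶ B) :
    X.toCoalg.map (X.ofCoalg.map f) = (X.termIso A).hom ≫ f ≫ (X.termIso B).inv :=
  X.toCoalg.map_preimage _

lemma S_map_ofCoalg_map {A B : X.adj.toComonad.Coalgebra} (f : A ⟶ B) :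
    X.S.map (X.ofCoalg.map f) = (X.termIso A).hom.f ≫ f.f ≫ (X.termIso B).inv.f :=
  congrArg Comonad.Coalgebra.Hom.f (X.toCoalg_map_ofCoalg_map f)

lemma ofCoalg_comp_du : X.ofCoalg ⋙ X.du = X.coalgProj := by
  have h : ∀ {A B : X.adj.toComonad.Coalgebra} (f : A ⟶ B),
      X.du.IsHomLift (X.types.p.map f.f) (X.ofCoalg.map f) := by
    intro A B f
    have hA := X.termIso_vertical A
    have := X.termIso_inv_vertical B
    rw [isHomLift_du_iff, S_map_ofCoalg_map]
    have : X.types.p.IsHomLift (X.types.p.map f.f) (f.f ≫ (X.termIso B).inv.f) :=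
      IsHomLift.comp_lift_id_right' X.types.p _ _ (X.types.p.obj B.A) _
    exact @IsHomLift.comp_lift_id_left' _ _ _ _ X.types.p _ _ _ _ _ hA _ _ _ _ this
  refine CategoryTheory.Functor.ext (fun A => ?_) fun A B f => ?_
  · exact @IsHomLift.domain_eq _ _ _ _ X.du _ _ _ _ _ _ (h (𝟙 A))
  · exact @IsHomLift.fac' _ _ _ _ X.du _ _ _ _ _ _ (h f)

lemma isCart_ofCoalg_map {A B : X.adj.toComonad.Coalgebra} (f : A ⟶ B)
    (hf : IsCart X.coalgProj f) : IsCart X.du (X.ofCoalg.map f) := by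
  refine X.isCart_of_isCart_coalgProj ?_
  rw [toCoalg_map_ofCoalg_map]
  exact (isCart_of_isIso _ _).comp (hf.comp (isCart_of_isIso _ _))

/-- The counit of the pseudo-inverse of the comparison functor. -/
noncomputable def ofCoalgToCoalg : X.ofCoalg ⋙ X.toCoalg ≅ 𝟭 _ :=
  NatIso.ofComponents X.termIso fun f => by
    rw [Functor.comp_map, toCoalg_map_ofCoalg_map]; simp

/-- The unit of the pseudo-inverse of the comparison functor. -/
noncomputable def toCoalgOfCoalg : 𝟭 _ ≅ X.toCoalg ⋙ X.ofCoalg :=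
  NatIso.ofComponents (fun t => X.toCoalg.preimageIso (X.termIso (X.toCoalg.obj t)).symm)
    fun f => X.toCoalg.map_injective (by simp)

end GCwfLoose

/-! ### Equality of 1-cells and 2-cells -/

namespace WCCmd

lemma Hom.ext_toCmd {X Y : WCCmd.{v, u}} {f g : Hom X Y} (h : f.fib = g.fib)
    (h' : f.toCmd = g.toCmd) : f = g := by
  obtain ⟨F, θ, _, _⟩ := f
  obtain ⟨G, θ', _, _⟩ := g
  obtain rfl : F = G := h
  simpa using h'

lemma eq_eqToHom_comp {X Y : WCCmd.{v, u}} {f g f' g' : X ⟶ Y} (h : f = f')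
    (h' : g' = g) (a : f ⟶ g) (b : f' ⟶ g') (hab : Hom₂.fib a ≍ Hom₂.fib b) :
    a = eqToHom h ≫ b ≫ eqToHom h' := by
  subst h h'
  rw [eqToHom_refl, eqToHom_refl, Category.id_comp, Category.comp_id]
  exact hom_ext (eq_of_heq hab)

lemma hom₂_heq {X Y : WCCmd.{v, u}} {f g f' g' : X ⟶ Y} (h : f = f')
    (h' : g = g') (a : f ⟶ g) (b : f' ⟶ g') (hab : Hom₂.fib a ≍ Hom₂.fib b) : a ≍ b := by
  subst h h'
  exact heq_of_eq (hom_ext (eq_of_heq hab))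

lemma isIdentity_mk {X Y : WCCmd.{v, u}} {f g : X ⟶ Y} (h : f = g) (a : f ⟶ g)
    (ha : IsIdentity (Hom₂.fib a)) : IsIdentity a := by
  subst h
  exact ⟨rfl, hom_ext ha.choose_spec⟩

end WCCmd

namespace GCwfLoose

lemma Hom.ext_toAdj {X Y : GCwfLoose.{v, u}} {f g : Hom X Y} (h : f.types = g.types)
    (h' : f.toAdj = g.toAdj) : f = g := by
  obtain ⟨F, G, _, _, ζ, _⟩ := f
  obtain ⟨F', G', _, _, ζ', _⟩ := g
  obtain rfl : F = F' := h
  obtain rfl : G = G' := congrArg AdjLoose.Hom.G h'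
  obtain rfl : ζ = ζ' := by simpa using h'
  rfl

lemma eq_eqToHom_comp {X Y : GCwfLoose.{v, u}} {f g f' g' : X ⟶ Y} (h : f = f')
    (h' : g' = g) (a : f ⟶ g) (b : f' ⟶ g') (hab : Hom₂.types a ≍ Hom₂.types b)
    (hab' : Hom₂.φ' a ≍ Hom₂.φ' b) : a = eqToHom h ≫ b ≫ eqToHom h' := by
  subst h h'
  rw [eqToHom_refl, eqToHom_refl, Category.id_comp, Category.comp_id]
  exact hom_ext (eq_of_heq hab) (eq_of_heq hab')

/-- A 2-cell is an identity if the underlying 2-cells of fibrations and of adjunctions are. -/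
lemma isIdentity_mk {X Y : GCwfLoose.{v, u}} {f g : X ⟶ Y} (a : f ⟶ g)
    (h : IsIdentity (Hom₂.types a)) (h' : IsIdentity (Hom₂.toAdj a)) : IsIdentity a := by
  obtain rfl : f = g := Hom.ext_toAdj h.choose h'.choose
  exact ⟨rfl, hom_ext h.choose_spec (congrArg AdjLoose.Hom₂.ψ h'.choose_spec)⟩

/-- Equality of 2-cells `a = b ≫ c` up to identity 2-cells, from the corresponding equalities
of the underlying 2-cells of fibrations and of adjunctions. -/
lemma eq_eqToHom_comp₂ {X Y : GCwfLoose.{v, u}} {f g f₁ g₁ f₂ g₂ : X ⟶ Y} (h₁ : f = f₁)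
    (h₂ : g₁ = f₂) (h₃ : g₂ = g) (a : f ⟶ g) (b : f₁ ⟶ g₁) (c : f₂ ⟶ g₂)
    (h : Hom₂.types a = eqToHom (congrArg Hom.types h₁) ≫ Hom₂.types b ≫
      eqToHom (congrArg Hom.types h₂) ≫ Hom₂.types c ≫ eqToHom (congrArg Hom.types h₃))
    (h' : ∃ (k₁ : Hom.toAdj f = Hom.toAdj f₁) (k₂ : Hom.toAdj g₁ = Hom.toAdj f₂)
      (k₃ : Hom.toAdj g₂ = Hom.toAdj g), Hom₂.toAdj a = eqToHom k₁ ≫ Hom₂.toAdj b ≫ eqToHom k₂ ≫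
        Hom₂.toAdj c ≫ eqToHom k₃) :
    a = eqToHom h₁ ≫ b ≫ eqToHom h₂ ≫ c ≫ eqToHom h₃ := by
  subst h₁ h₂ h₃
  obtain ⟨_, _, _, h'⟩ := h'
  simp only [eqToHom_refl, Category.id_comp, Category.comp_id] at h h' ⊢
  exact hom_ext h (congrArg AdjLoose.Hom₂.ψ h')

/-- An invertible 2-cell from invertible natural transformations that form a 2-cell. -/
@[reducible]
def isoOfComponents {X Y : GCwfLoose.{v, u}} {f g : X ⟶ Y} (e : Hom.types f ≅ Hom.types g)
    (e' : Hom.G f ≅ Hom.G g)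
    (lifts : ∀ a, Y.du.IsHomLift (e.hom.ψ.app (X.du.obj a)) (e'.hom.app a))
    (comm : ∀ a, (Hom.ζ f).hom.app a ≫ e.hom.φ.app (X.S.obj a) =
      Y.S.map (e'.hom.app a) ≫ (Hom.ζ g).hom.app a) : f ≅ g where
  hom := { types := e.hom, φ' := e'.hom, lifts := lifts, comm := comm }
  inv :=
    { types := e.inv
      φ' := e'.inv
      lifts a := by
        have h₁ := congrArg (fun k => (Fib.Hom₂.ψ k).app (X.du.obj a)) e.hom_inv_id
        have h₂ := congrArg (fun k => (Fib.Hom₂.ψ k).app (X.du.obj a)) e.inv_hom_id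
        let i : (Hom.types f).base.obj (X.du.obj a) ≅ (Hom.types g).base.obj (X.du.obj a) :=
          ⟨e.hom.ψ.app _, e.inv.ψ.app _, h₁, h₂⟩
        have : Y.du.IsHomLift i.hom (e'.app a).hom := lifts a
        exact IsHomLift.inv_lift_inv Y.du i (e'.app a)
      comm a := by
        have h₁ := congrArg (fun k => (Fib.Hom₂.φ k).app (X.S.obj a)) e.hom_inv_id
        have h₃ : e.hom.φ.app (X.S.obj a) ≫ e.inv.φ.app (X.S.obj a) = 𝟙 _ := h₁
        rw [← cancel_epi (Y.S.map (e'.hom.app a)), ← reassoc_of% (comm a), h₃, ← Y.S.map_comp_assoc]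
        simp }
  hom_inv_id := hom_ext e.hom_inv_id e'.hom_inv_id
  inv_hom_id := hom_ext e.inv_hom_id e'.inv_hom_id

end GCwfLoose

lemma coalgebra_natTrans_heq {C D : Type*} [Category C] [Category D] {K : Comonad D}
    {F G F' G' : C ⥤ K.Coalgebra} (hF : F = F') (hG : G = G') (a : F ⟶ G) (b : F' ⟶ G')
    (h : ∀ A, (a.app A).f ≍ (b.app A).f) : a ≍ b :=
  natTrans_heq hF hG _ _ fun A =>
    coalgebra_hom_heq (Functor.congr_obj hF A) (Functor.congr_obj hG A) _ _ (h A)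

/-! ### The 2-functors between comonads and generalised categories with families -/

namespace WCCmd

/-- The generalised category with families whose terms are the coalgebras of a weakening and
contraction comonad. The unit at a coalgebra is its structure map, hence cartesian. -/
@[reducible]
def toGCwf (X : WCCmd.{v, u}) : GCwfLoose.{v, u} where
  types := X.fib
  T := X.K.Coalgebra
  du := X.coalgProj
  du_isFibered := X.coalgProj_isFibered
  S := X.K.forget
  S_comp := rfl
  S_cart _ hf := X.isCart_coalgProj_iff.1 hf
  D := X.K.cofree
  adj := emAdj X.K
  unit_cart A := X.isCart_of_isCart_f (X.a_isCart A)
  counit_cart := X.counit_cart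

/-- The gcwf morphism between gcwfs of coalgebras induced by a lax morphism `(C, H, θ)`. -/
@[reducible]
def Hom.toGCwf {X Y : WCCmd.{v, u}} (f : Hom X Y) : GCwfLoose.Hom X.toGCwf Y.toGCwf where
  types := f.fib
  G := Cmd.coalg f.toCmd
  G_comp := congrArg (X.K.forget ⋙ ·) f.fib.w
  G_cart k hk := Y.isCart_of_isCart_f (f.fib.cart k.f (X.isCart_coalgProj_iff.1 hk))
  ζ := Iso.refl _
  vertical A := IsHomLift.id (Functor.congr_obj f.fib.w A.A)

end WCCmd

/-- The 2-functor that sends a weakening and contraction comonad to its gcwf of coalgebras. -/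
def wcCmdToGCwf : StrictPseudofunctor WCCmd.{v, u} GCwfLoose.{v, u} :=
  StrictPseudofunctor.mk''
    { obj X := X.toGCwf
      map f := WCCmd.Hom.toGCwf f
      map₂ a :=
        { types := WCCmd.Hom₂.fib a
          φ' := Cmd.coalg₂ (WCCmd.Hom₂.toCmd a)
          lifts A := isHomLift_comp_iff.2 ((WCCmd.Hom₂.fib a).lifts A.A)
          comm _ := (Category.id_comp _).trans (Category.comp_id _).symm }
      map₂_id _ := GCwfLoose.hom_ext rfl rfl
      map₂_comp _ _ := GCwfLoose.hom_ext rfl rfl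
      map_id X := GCwfLoose.Hom.ext_toAdj rfl (cmdToAdj.map_id X.toCmd)
      map_comp f g := GCwfLoose.Hom.ext_toAdj rfl
        (cmdToAdj.map_comp (WCCmd.forgetCmd.map f) (WCCmd.forgetCmd.map g))
      map₂_whisker_left f g g' _ := GCwfLoose.eq_eqToHom_comp _ _ _ _ HEq.rfl
        (coalgebra_natTrans_heq (Cmd.coalg_comp (WCCmd.Hom.toCmd f) (WCCmd.Hom.toCmd g))
          (Cmd.coalg_comp (WCCmd.Hom.toCmd f) (WCCmd.Hom.toCmd g')) _ _ fun _ => HEq.rfl)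
      map₂_whisker_right {_ _ _ f f'} _ g := GCwfLoose.eq_eqToHom_comp _ _ _ _ HEq.rfl
        (coalgebra_natTrans_heq (Cmd.coalg_comp (WCCmd.Hom.toCmd f) (WCCmd.Hom.toCmd g))
          (Cmd.coalg_comp (WCCmd.Hom.toCmd f') (WCCmd.Hom.toCmd g)) _ _ fun _ => HEq.rfl) }

/-- The lax morphism of weakening and contraction comonads induced by a loose gcwf morphism. -/
@[reducible]
def GCwfLoose.Hom.toWCCmd {X Y : GCwfLoose.{v, u}} (f : GCwfLoose.Hom X Y) :
    WCCmd.Hom X.toWCCmd Y.toWCCmd where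
  fib := f.types
  θ := AdjLoose.θ f.toAdj
  counit := AdjLoose.θ_counit f.toAdj
  comult := AdjLoose.θ_comult f.toAdj

/-- The 2-functor that sends a gcwf to its weakening and contraction comonad. -/
def gcwfToWCCmd : StrictPseudofunctor GCwfLoose.{v, u} WCCmd.{v, u} :=
  StrictPseudofunctor.mk''
    { obj X := X.toWCCmd
      map f := GCwfLoose.Hom.toWCCmd f
      map₂ a :=
        { fib := GCwfLoose.Hom₂.types a
          comm := AdjLoose.θ_comm (GCwfLoose.Hom₂.toAdj a) }
      map₂_id _ := WCCmd.hom_ext rfl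
      map₂_comp _ _ := WCCmd.hom_ext rfl
      map_id X := WCCmd.Hom.ext_toCmd rfl (adjToCmd.map_id X.toAdj)
      map_comp f g := WCCmd.Hom.ext_toCmd rfl
        (adjToCmd.map_comp (GCwfLoose.forgetAdj.map f) (GCwfLoose.forgetAdj.map g))
      map₂_whisker_left _ _ _ _ := WCCmd.eq_eqToHom_comp _ _ _ _ HEq.rfl
      map₂_whisker_right _ _ := WCCmd.eq_eqToHom_comp _ _ _ _ HEq.rfl }

lemma wcCmdToGCwf_gcwfToWCCmd :
    wcCmdToGCwf.{v, u}.comp gcwfToWCCmd = StrictPseudofunctor.id _ := by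
  have h : ∀ {X Y : WCCmd.{v, u}} (f : X ⟶ Y),
      (wcCmdToGCwf.{v, u}.comp gcwfToWCCmd).map f = f := fun f =>
    WCCmd.Hom.ext_toCmd rfl (Cmd.homToCmd_emHom (WCCmd.Hom.toCmd f))
  exact strictPseudofunctor_hext (fun _ => rfl) (fun f => heq_of_eq (h f))
    fun _ => WCCmd.hom₂_heq (h _) (h _) _ _ HEq.rfl

namespace GCwfLoose

/-- The gcwf morphism given by the identity on types and by the comparison functor on terms. -/
@[reducible]
def comparison (X : GCwfLoose.{v, u}) : Hom X ((gcwfToWCCmd.comp wcCmdToGCwf).obj X) where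
  types := Fib.Hom.id _
  G := X.toCoalg
  G_comp := X.S_comp
  G_cart _ hf := X.isCart_coalgProj_of_isCart hf
  ζ := Iso.refl X.S
  vertical a := IsHomLift.id (Functor.congr_obj X.S_comp a)

/-- The invertible 2-cell `(id, ζ)` that makes the comparison morphisms pseudonatural. -/
@[reducible]
def unitNat {X Y : GCwfLoose.{v, u}} (f : X ⟶ Y) :
    f ≫ comparison Y ≅ comparison X ≫ (gcwfToWCCmd.comp wcCmdToGCwf).map f :=
  isoOfComponents (Iso.refl (Hom.types f)) (AdjLoose.ζHat (Hom.toAdj f))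
    (fun a => isHomLift_comp_iff.2 (Hom.vertical f a))
    (AdjLoose.Hom₂.comm (AdjLoose.unitNat (Hom.toAdj f)).hom)

lemma unitNat_comp {X Y Z : GCwfLoose.{v, u}} (f : X ⟶ Y) (g : Y ⟶ Z) : ∃ h₁ h₂ h₃,
    (unitNat (f ≫ g)).hom = eqToHom h₁ ≫ f ◁ (unitNat g).hom ≫ eqToHom h₂ ≫
      (unitNat f).hom ▷ (gcwfToWCCmd.comp wcCmdToGCwf).map g ≫ eqToHom h₃ := by
  have h₃ : (comparison X ≫ (gcwfToWCCmd.comp wcCmdToGCwf).map f) ≫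
      (gcwfToWCCmd.comp wcCmdToGCwf).map g =
        comparison X ≫ (gcwfToWCCmd.comp wcCmdToGCwf).map (f ≫ g) :=
    (Strict.assoc _ _ _).trans
      (congrArg (comparison X ≫ ·) ((gcwfToWCCmd.comp wcCmdToGCwf).map_comp f g).symm)
  refine ⟨_, _, _, eq_eqToHom_comp₂ (Strict.assoc f g _)
    (Strict.assoc f _ ((gcwfToWCCmd.comp wcCmdToGCwf).map g)).symm h₃ _ _ _ ?_ ?_⟩
  · have h : ∀ {P Q R : Fib.{v, u}} (a : P ⟶ Q) (b : Q ⟶ R),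
        𝟙 (a ≫ b) = 𝟙 (a ≫ b) ≫ a ◁ 𝟙 b ≫ 𝟙 (a ≫ b) ≫ 𝟙 a ▷ b ≫ 𝟙 (a ≫ b) := by simp
    exact h (Hom.types f) (Hom.types g)
  · exact naturality_comp_eq cmdAdj.unit (forgetAdj.map f) (forgetAdj.map g)

lemma map₂_unitNat {X Y : GCwfLoose.{v, u}} (f : X ⟶ Y) :
    IsIdentity (gcwfToWCCmd.map₂ (unitNat f).hom) := by
  have h : gcwfToWCCmd.map (f ≫ comparison Y) =
      gcwfToWCCmd.map (comparison X ≫ (gcwfToWCCmd.comp wcCmdToGCwf).map f) :=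
    WCCmd.Hom.ext_toCmd rfl (AdjLoose.left_triangle_naturality (forgetAdj.map f))
  exact WCCmd.isIdentity_mk h _ ⟨rfl, rfl⟩

end GCwfLoose

/-- The bireflection of weakening and contraction comonads into gcwfs. -/
def wcCmdGCwf : Bireflection WCCmd.{v, u} GCwfLoose.{v, u} where
  R := wcCmdToGCwf
  L := gcwfToWCCmd
  unit := mkStrongTrans _ _ (fun X => GCwfLoose.comparison X)
    (fun f => GCwfLoose.unitNat f)
    (fun a => GCwfLoose.hom_ext
      ((Category.comp_id (GCwfLoose.Hom₂.types a)).trans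
        (Category.id_comp (GCwfLoose.Hom₂.types a)).symm)
      (congrArg AdjLoose.Hom₂.ψ (cmdAdj.unit.naturality_naturality (GCwfLoose.Hom₂.toAdj a))))
    (fun X => GCwfLoose.isIdentity_mk _ ⟨rfl, rfl⟩ (naturality_id_isIdentity cmdAdj.unit X.toAdj))
    (fun f g => GCwfLoose.unitNat_comp f g)
  counit := wcCmdToGCwf_gcwfToWCCmd
  left_triangle X := ⟨rfl, WCCmd.Hom.ext_toCmd rfl (AdjLoose.left_triangle X.toAdj)⟩
  left_triangle₂ f := GCwfLoose.map₂_unitNat f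
  right_triangle Z := ⟨rfl, GCwfLoose.Hom.ext_toAdj rfl (AdjLoose.comparison_em Z.toCmd)⟩
  right_triangle₂ h := GCwfLoose.isIdentity_mk _ ⟨rfl, rfl⟩
    (cmdAdj.right_triangle₂ (WCCmd.forgetCmd.map h))
  swallowtail X := GCwfLoose.isIdentity_mk _ ⟨rfl, rfl⟩ (cmdAdj.swallowtail X.toAdj)

/-! ### The comparison morphisms are equivalences -/

namespace GCwfLoose

/-- The loose gcwf morphism from coalgebras to terms that is inverse to the comparison morphism up to
invertible 2-cells. -/
@[reducible]
noncomputable def comparisonInv (X : GCwfLoose.{v, u}) :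
    Hom ((gcwfToWCCmd.comp wcCmdToGCwf).obj X) X where
  types := Fib.Hom.id _
  G := X.ofCoalg
  G_comp := X.ofCoalg_comp_du
  G_cart f hf := X.isCart_ofCoalg_map f hf
  ζ := Functor.isoWhiskerRight X.ofCoalgToCoalg X.adj.toComonad.forget
  vertical A := X.termIso_vertical A

lemma S_map_toCoalgOfCoalg (X : GCwfLoose.{v, u}) (t : X.T) :
    X.S.map (X.toCoalgOfCoalg.hom.app t) = (X.termIso (X.toCoalg.obj t)).inv.f :=
  congrArg Comonad.Coalgebra.Hom.f (X.toCoalg.map_preimage (X.termIso (X.toCoalg.obj t)).inv)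

/-- The vertical isomorphism between a term and the term chosen for its coalgebra, as an invertible
2-cell. -/
noncomputable def comparisonUnit (X : GCwfLoose.{v, u}) :
    𝟙 X ≅ (comparison X : X ⟶ _) ≫ comparisonInv X :=
  isoOfComponents (Iso.refl (Fib.Hom.id X.types)) X.toCoalgOfCoalg
    (fun t => by
      have h : X.types.p.IsHomLift (𝟙 (X.types.p.obj (X.S.obj t)))
          (X.termIso (X.toCoalg.obj t)).inv.f := X.termIso_inv_vertical (X.toCoalg.obj t)
      rw [show X.types.p.obj (X.S.obj t) = X.du.obj t from Functor.congr_obj X.S_comp t,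
        ← S_map_toCoalgOfCoalg] at h
      exact X.isHomLift_du_iff.2 h)
    (fun t => by
      have h : (X.termIso (X.toCoalg.obj t)).inv.f ≫ (X.termIso (X.toCoalg.obj t)).hom.f =
          𝟙 (X.S.obj t) :=
        congrArg Comonad.Coalgebra.Hom.f (X.termIso (X.toCoalg.obj t)).inv_hom_id
      refine (Category.id_comp _).trans ?_
      rw [S_map_toCoalgOfCoalg]
      refine h.symm.trans (congrArg (_ ≫ ·) ?_)
      exact (Category.comp_id _).symm)

/-- The vertical isomorphism between the coalgebra of the term chosen for a coalgebra and the latter,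
as an invertible 2-cell. -/
noncomputable def comparisonCounit (X : GCwfLoose.{v, u}) :
    (comparisonInv X : _ ⟶ X) ≫ comparison X ≅ 𝟙 ((gcwfToWCCmd.comp wcCmdToGCwf).obj X) :=
  isoOfComponents (Iso.refl (Fib.Hom.id X.types)) X.ofCoalgToCoalg
    (fun A => isHomLift_comp_iff.2 (X.termIso_vertical A))
    (fun A => congrArg (· ≫ 𝟙 A.A) (Category.id_comp (X.termIso A).hom.f))

end GCwfLoose

lemma wcCmdGCwf_isBiequivalence : wcCmdGCwf.{v, u}.IsBiequivalence := fun X =>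
  ⟨Bicategory.Equivalence.mkOfAdjointifyCounit X.comparisonUnit X.comparisonCounit, rfl⟩

/-! ### Identity arrows -/

section Identities

variable {C D : Type*} [Category C] [Category D]

lemma IsIdentity.isIso {X Y : C} {f : X ⟶ Y} (h : IsIdentity f) : IsIso f := by
  obtain ⟨rfl, rfl⟩ := h
  infer_instance

lemma IsIdentity.iso_inv {X Y : C} {e : X ≅ Y} (h : IsIdentity e.hom) : IsIdentity e.inv := by
  obtain ⟨rfl, h⟩ := h
  refine ⟨rfl, ?_⟩
  obtain rfl : e = Iso.refl X := Iso.ext h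
  rfl

/-- A natural transformation whose components are identities is an identity; in particular its source
and target agree on arrows, by naturality. -/
lemma isIdentity_of_app {F G : C ⥤ D} {a : F ⟶ G} (h : ∀ X, IsIdentity (a.app X)) :
    IsIdentity a := by
  refine isIdentity_natTrans (CategoryTheory.Functor.ext (fun X => (h X).choose) fun X Y f => ?_) h
  have hn := a.naturality f
  rw [(h X).choose_spec, (h Y).choose_spec] at hn
  rw [← reassoc_of% hn]
  simp

lemma isIdentity_coalgebra {K : Comonad C} {A B : K.Coalgebra} {f : A ⟶ B}
    (h : IsIdentity f.f) : IsIdentity f := by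
  obtain ⟨A, a, _, _⟩ := A
  obtain ⟨B, b, _, _⟩ := B
  obtain ⟨f, hf⟩ := f
  obtain ⟨h₁, h₂⟩ := h
  dsimp at h₁ h₂ f hf
  subst h₁
  obtain rfl : f = 𝟙 A := h₂
  obtain rfl : a = b := by simpa using hf
  exact ⟨rfl, rfl⟩

end Identities

lemma AdjLoose.isIdentity_of_components {X Y : AdjLoose.{v, u}} {f g : X ⟶ Y} (a : f ⟶ g)
    (h : IsIdentity (Hom₂.φ a)) (h' : IsIdentity (Hom₂.ψ a)) : IsIdentity a := by
  obtain ⟨F, G, ζ⟩ := f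
  obtain ⟨F', G', ζ'⟩ := g
  obtain ⟨φ, ψ, comm⟩ := a
  obtain ⟨h₁, h₂⟩ := h
  obtain ⟨h₁', h₂'⟩ := h'
  dsimp at h₁ h₂ h₁' h₂' φ ψ comm
  subst h₁ h₁'
  obtain rfl : φ = 𝟙 F := h₂
  obtain rfl : ψ = 𝟙 G := h₂'
  obtain rfl : ζ = ζ' := by
    ext A
    simpa using comm A
  exact ⟨rfl, rfl⟩

/-- The comparison morphisms are strictly natural with respect to gcwf morphisms. -/
lemma GCwfLoose.isIdentity_unitNat {X Y : GCwfLoose.{v, u}} (f : X ⟶ Y) (hf : left.P f) :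
    IsIdentity (unitNat f).hom :=
  isIdentity_mk _ ⟨rfl, rfl⟩ (AdjLoose.isIdentity_of_components _ ⟨rfl, rfl⟩
    (isIdentity_of_app fun A => isIdentity_coalgebra (IsIdentity.app hf A)))

/-! ### Pseudo and strict morphisms -/

/-- The mate of the identity 2-cell of `emHom f` lifts `θ` to coalgebras. -/
lemma Cmd.mate_emHom {X Y : Cmd.{v, u}} (f : Hom X Y) (A : X.C) :
    ((AdjLoose.mate (emHom f)).app A).f = f.θ.app A := by
  have h : AdjLoose.θ (emHom f) = f.θ := eq_of_heq (Cmd.Hom.mk.inj (homToCmd_emHom f)).2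
  exact (Category.id_comp _).symm.trans (congrArg (fun t => t.app A) h)

lemma Cmd.pseudo_emHom {X Y : Cmd.{v, u}} (f : X ⟶ Y) (hf : pseudo.P f) :
    AdjLoose.pseudo.P (cmdToAdj.map f) := by
  refine (NatTrans.isIso_iff_isIso_app (AdjLoose.mate (emHom f))).2 fun A => ?_
  have h : IsIso ((AdjLoose.mate (emHom f)).app A).f := by
    rw [mate_emHom]
    exact (NatTrans.isIso_iff_isIso_app (Hom.θ f)).1 hf A
  exact Comonad.coalgebra_iso_of_iso _ _

lemma Cmd.strict_emHom {X Y : Cmd.{v, u}} (f : X ⟶ Y) (hf : strict.P f) :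
    AdjLoose.strict.P (cmdToAdj.map f) :=
  isIdentity_of_app fun A => isIdentity_coalgebra (by
    have h : IsIdentity ((Hom.θ f).app A) := IsIdentity.app hf A
    exact (mate_emHom f A).symm ▸ h)

namespace AdjLoose

variable {X Y Z : AdjLoose.{v, u}}

lemma pseudo_homToCmd (f : X ⟶ Y) (hf : pseudo.P f) : Cmd.pseudo.P (adjToCmd.map f) := by
  refine (NatTrans.isIso_iff_isIso_app (θ f)).2 fun A => ?_
  have := (NatTrans.isIso_iff_isIso_app (mate f)).1 hf A
  rw [θ_app]
  infer_instance

lemma strict_homToCmd (f : X ⟶ Y) (hl : left.P f) (hs : strict.P f) :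
    Cmd.strict.P (adjToCmd.map f) :=
  isIdentity_of_app fun A =>
    ((IsIdentity.iso_inv hl).app (X.R.obj A)).comp ((IsIdentity.app hs A).map Y.L)

lemma strict_comparison (X : AdjLoose.{v, u}) : strict.P (comparison X) :=
  isIdentity_of_app fun A => isIdentity_coalgebra ⟨rfl, by
    change X.L.map (X.adj.unit.app (X.R.obj A)) ≫ X.L.map (X.R.map (𝟙 _)) ≫
      X.L.map (X.R.map (X.adj.counit.app A)) = 𝟙 _
    simp [← Functor.map_comp]⟩

lemma pseudo_comparison (X : AdjLoose.{v, u}) : pseudo.P (comparison X) :=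
  (strict_comparison X).isIso

/-- The mates are natural with respect to 2-cells. -/
lemma mate_naturality {f g : Hom X Y} (a : f ⟶ g) (A : X.C) :
    (mate f).app A ≫ Y.R.map (a.φ.app A) = a.ψ.app (X.R.obj A) ≫ (mate g).app A := by
  have h1 := a.comm (X.R.obj A)
  have h2 := Y.adj.unit.naturality (a.ψ.app (X.R.obj A))
  have h3 := a.φ.naturality (X.adj.counit.app A)
  dsimp only [Functor.comp_obj, Functor.comp_map, Functor.id_obj, Functor.id_map] at h1 h2 h3
  simp only [mate_app, Category.assoc]
  rw [reassoc_of% h2]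
  simp only [← Functor.map_comp]
  rw [h3, reassoc_of% h1]

lemma pseudo_of_iso {f g : X ⟶ Y} (e : f ≅ g) (hf : pseudo.P f) : pseudo.P g := by
  refine (NatTrans.isIso_iff_isIso_app (mate g)).2 fun A => ?_
  have := (NatTrans.isIso_iff_isIso_app (mate f)).1 hf A
  have h := mate_naturality e.hom A
  have h₁ : IsIso ((Hom₂.ψ e.hom).app (X.R.obj A)) :=
    ⟨(Hom₂.ψ e.inv).app (X.R.obj A),
      congrArg (fun k => (Hom₂.ψ k).app (X.R.obj A)) e.hom_inv_id,
      congrArg (fun k => (Hom₂.ψ k).app (X.R.obj A)) e.inv_hom_id⟩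
  have h₂ : IsIso ((Hom₂.φ e.hom).app A) :=
    ⟨(Hom₂.φ e.inv).app A, congrArg (fun k => (Hom₂.φ k).app A) e.hom_inv_id,
      congrArg (fun k => (Hom₂.φ k).app A) e.inv_hom_id⟩
  have : IsIso ((Hom₂.ψ e.hom).app (X.R.obj A) ≫ (mate g).app A) := by
    rw [← h]
    infer_instance
  exact IsIso.of_isIso_comp_left ((Hom₂.ψ e.hom).app (X.R.obj A)) _

/-- Cancellation for pseudo morphisms. The mate of a composite `f ≫ g` involves that of `g` only at
objects in the image of `F`, whence the surjectivity assumption. -/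
lemma pseudo_of_comp (f : X ⟶ Y) (g : Y ⟶ Z) (hf : pseudo.P f) (hfg : pseudo.P (f ≫ g))
    (hs : Function.Surjective (Hom.F f).obj) : pseudo.P g := by
  refine (NatTrans.isIso_iff_isIso_app (mate g)).2 fun A => ?_
  obtain ⟨A, rfl⟩ := hs A
  have h₁ := (NatTrans.isIso_iff_isIso_app (mate f)).1 hf A
  have h₂ : IsIso ((mate (Hom.comp f g)).app A) :=
    (NatTrans.isIso_iff_isIso_app (mate (Hom.comp f g))).1 hfg A
  rw [mate_comp] at h₂
  exact IsIso.of_isIso_comp_left ((Hom.G g).map ((mate f).app A)) _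

end AdjLoose

/-- The inverse of a comparison morphism is pseudo. -/
lemma GCwfLoose.pseudo_comparisonInv (X : GCwfLoose.{v, u}) : pseudo.P (comparisonInv X) := by
  have h : AdjLoose.pseudo.P (forgetAdj.map (comparison X : X ⟶ _) ≫
      forgetAdj.map (comparisonInv X)) :=
    AdjLoose.pseudo_of_iso (forgetAdj.map₂Iso X.comparisonUnit) (AdjLoose.pseudo.id_mem X.toAdj)
  exact AdjLoose.pseudo_of_comp _ _ (AdjLoose.pseudo_comparison X.toAdj) h fun A => ⟨A, rfl⟩

/-! ### Restriction of bireflections -/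

namespace WideSub

variable {B : Type u₁} [Bicategory.{w₁, v₁} B] {W : OneCellClass B}

lemma hom_heq {X Y X' Y' : WideSub W} (hX : X = X') (hY : Y = Y') (f : X ⟶ Y) (g : X' ⟶ Y')
    (h : Hom.toHom f ≍ Hom.toHom g) : f ≍ g := by
  subst hX hY
  exact heq_of_eq (Hom.ext (eq_of_heq h))

lemma hom₂_heq {X Y X' Y' : WideSub W} (hX : X = X') (hY : Y = Y') {f g : X ⟶ Y} {f' g' : X' ⟶ Y'}
    (hf : f ≍ f') (hg : g ≍ g') (a : f ⟶ g) (b : f' ⟶ g') (h : down a ≍ down b) : a ≍ b := by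
  subst hX hY hf hg
  exact h

/-- 2-functors into a wide 2-full sub-2-category are equal if they are equal as 2-functors into the
ambient 2-category. -/
lemma ext_of_comp_incl [Strict B] {A : Type u₂} [Bicategory.{w₂, v₂} A]
    {F G : StrictPseudofunctor A (WideSub W)} (h : F.comp (incl W) = G.comp (incl W)) : F = G := by
  have h₀ : ∀ X, F.obj X = G.obj X := fun X =>
    WideSub.ext (congrArg (fun K => K.obj X) h)
  have h₁ : ∀ {X Y : A} (f : X ⟶ Y), F.map f ≍ G.map f := fun f =>
    hom_heq (h₀ _) (h₀ _) _ _ (show (F.comp (incl W)).map f ≍ (G.comp (incl W)).map f by rw [h])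
  exact strictPseudofunctor_hext h₀ h₁ fun a => hom₂_heq (h₀ _) (h₀ _) (h₁ _) (h₁ _) _ _
    (show (F.comp (incl W)).map₂ a ≍ (G.comp (incl W)).map₂ a by rw [h])

end WideSub

namespace Bireflection

variable {C : Type u₁} [Bicategory.{w₁, v₁} C] {D : Type u₂} [Bicategory.{w₂, v₂} D]
  [Strict C] [Strict D] (β : Bireflection C D)

/-- Restriction of a bireflection to wide 2-full sub-2-categories on both sides. -/
def restrict (W : OneCellClass C) (W' : OneCellClass D)
    (hR : ∀ {X Y : C} (f : X ⟶ Y), W.P f → W'.P (β.R.map f))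
    (hL : ∀ {X Y : D} (f : X ⟶ Y), W'.P f → W.P (β.L.map f)) (hu : ∀ X, W'.P (β.unit.app X)) :
    Bireflection (WideSub W) (WideSub W') where
  R := WideSub.restrict β.R W W' hR
  L := WideSub.restrict β.L W' W hL
  unit := mkStrongTrans _ _ (fun X => ⟨β.unit.app X.of, hu _⟩)
    (fun f => WideSub.Hom.isoMk (β.unit.naturality (WideSub.Hom.toHom f)))
    (fun a => β.unit.naturality_naturality (WideSub.down a))
    (fun X => isIdentity_of_down _ (naturality_id_isIdentity β.unit X.of))
    (fun f g => by
      obtain ⟨h₁, h₂, h₃, h⟩ := naturality_comp_eq β.unit (WideSub.Hom.toHom f) (WideSub.Hom.toHom g)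
      exact ⟨_, _, _, eq_eqToHom_comp₂ (WideSub.Hom.ext h₁) (WideSub.Hom.ext h₂)
        (WideSub.Hom.ext h₃) _ _ _ h⟩)
  counit := WideSub.ext_of_comp_incl (strictPseudofunctor_ext
    (congrArg (fun F => ((WideSub.incl W).comp F).toPrelaxFunctor) β.counit))
  left_triangle X := isIdentity_mk _ (β.left_triangle X.of)
  left_triangle₂ f := isIdentity_of_down _ (β.left_triangle₂ (WideSub.Hom.toHom f))
  right_triangle X := isIdentity_mk _ (β.right_triangle X.of)
  right_triangle₂ f := isIdentity_of_down _ (β.right_triangle₂ (WideSub.Hom.toHom f))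
  swallowtail X := isIdentity_of_down _ (β.swallowtail X.of)

end Bireflection


/-! ### Lifting and restriction of the biequivalence -/

lemma wcCmdGCwf_lifts : wcCmdGCwf.{v, u}.Lifts cmdAdj WCCmd.forgetCmd GCwfLoose.forgetAdj where
  R := strictPseudofunctor_ext rfl
  L := strictPseudofunctor_ext rfl
  unit _ := HEq.rfl
  unit₂ _ := HEq.rfl

lemma wcCmdGCwf_isOver : wcCmdGCwf.{v, u}.IsOver WCCmd.forgetFib GCwfLoose.forgetFib where
  R := strictPseudofunctor_ext rfl
  L := strictPseudofunctor_ext rfl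
  unit _ := ⟨rfl, rfl⟩
  unit₂ _ := ⟨rfl, rfl⟩

/-- The 2-reflection of weakening and contraction comonads into gcwfs and gcwf morphisms. -/
def wcCmdGCwfLeft : Bireflection WCCmd.{v, u} GCwf.{v, u} :=
  wcCmdGCwf.restrictRight GCwfLoose.left (fun _ => ⟨rfl, rfl⟩) (fun _ => ⟨rfl, rfl⟩)

lemma wcCmdGCwfLeft_lifts :
    wcCmdGCwfLeft.{v, u}.Lifts wcCmdGCwf (StrictPseudofunctor.id _)
      (WideSub.incl GCwfLoose.left) where
  R := strictPseudofunctor_ext rfl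
  L := strictPseudofunctor_ext rfl
  unit _ := HEq.rfl
  unit₂ _ := HEq.rfl

lemma wcCmdGCwfLeft_lifts_cmdAdjLeft :
    wcCmdGCwfLeft.{v, u}.Lifts cmdAdjLeft WCCmd.forgetCmd GCwf.forgetAdj where
  R := strictPseudofunctor_ext rfl
  L := strictPseudofunctor_ext rfl
  unit _ := HEq.rfl
  unit₂ _ := HEq.rfl

lemma wcCmdGCwfLeft_is2Reflection : wcCmdGCwfLeft.{v, u}.Is2Reflection := fun f =>
  Bireflection.isIdentity_of_down _ (GCwfLoose.isIdentity_unitNat _ (WideSub.Hom.mem f))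

/-- The 2-reflection between pseudo morphisms of comonads and of gcwfs. -/
def wcCmdGCwfPs : Bireflection WCCmdPs.{v, u} GCwfPs.{v, u} :=
  wcCmdGCwf.restrict WCCmd.pseudo (GCwfLoose.left.inter GCwfLoose.pseudo)
    (fun f hf => ⟨⟨rfl, rfl⟩, Cmd.pseudo_emHom (WCCmd.forgetCmd.map f) hf⟩)
    (fun f hf => AdjLoose.pseudo_homToCmd (GCwfLoose.forgetAdj.map f) hf.2)
    (fun X => ⟨⟨rfl, rfl⟩, AdjLoose.pseudo_comparison X.toAdj⟩)

/-- The 2-reflection between strict morphisms of comonads and of gcwfs. -/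
def wcCmdGCwfStr : Bireflection WCCmdStr.{v, u} GCwfStr.{v, u} :=
  wcCmdGCwf.restrict WCCmd.strict (GCwfLoose.left.inter GCwfLoose.strict)
    (fun f hf => ⟨⟨rfl, rfl⟩, Cmd.strict_emHom (WCCmd.forgetCmd.map f) hf⟩)
    (fun f hf => AdjLoose.strict_homToCmd (GCwfLoose.forgetAdj.map f) hf.1 hf.2)
    (fun X => ⟨⟨rfl, rfl⟩, AdjLoose.strict_comparison X.toAdj⟩)

/-- The biequivalence between pseudo morphisms of comonads and pseudo loose morphisms of gcwfs. -/
def wcCmdGCwfLoosePs : Bireflection WCCmdPs.{v, u} GCwfLoosePs.{v, u} :=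
  wcCmdGCwf.restrict WCCmd.pseudo GCwfLoose.pseudo
    (fun f hf => Cmd.pseudo_emHom (WCCmd.forgetCmd.map f) hf)
    (fun f hf => AdjLoose.pseudo_homToCmd (GCwfLoose.forgetAdj.map f) hf)
    (fun X => AdjLoose.pseudo_comparison X.toAdj)

lemma wcCmdGCwfPs_lifts : wcCmdGCwfPs.{v, u}.Lifts wcCmdGCwfLeft (WideSub.incl WCCmd.pseudo)
    GCwfPs.incl where
  R := strictPseudofunctor_ext rfl
  L := strictPseudofunctor_ext rfl
  unit _ := HEq.rfl
  unit₂ _ := HEq.rfl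

lemma wcCmdGCwfStr_lifts : wcCmdGCwfStr.{v, u}.Lifts wcCmdGCwfLeft (WideSub.incl WCCmd.strict)
    GCwfStr.incl where
  R := strictPseudofunctor_ext rfl
  L := strictPseudofunctor_ext rfl
  unit _ := HEq.rfl
  unit₂ _ := HEq.rfl

lemma wcCmdGCwfLoosePs_lifts : wcCmdGCwfLoosePs.{v, u}.Lifts wcCmdGCwf
    (WideSub.incl WCCmd.pseudo) (WideSub.incl GCwfLoose.pseudo) where
  R := strictPseudofunctor_ext rfl
  L := strictPseudofunctor_ext rfl
  unit _ := HEq.rfl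
  unit₂ _ := HEq.rfl

lemma wcCmdGCwfPs_is2Reflection : wcCmdGCwfPs.{v, u}.Is2Reflection := fun f =>
  Bireflection.isIdentity_of_down _ (GCwfLoose.isIdentity_unitNat _ (WideSub.Hom.mem f).1)

lemma wcCmdGCwfStr_is2Reflection : wcCmdGCwfStr.{v, u}.Is2Reflection := fun f =>
  Bireflection.isIdentity_of_down _ (GCwfLoose.isIdentity_unitNat _ (WideSub.Hom.mem f).1)

lemma wcCmdGCwfLoosePs_isBiequivalence : wcCmdGCwfLoosePs.{v, u}.IsBiequivalence := fun X =>
  ⟨Bicategory.Equivalence.mkOfAdjointifyCounit (f := wcCmdGCwfLoosePs.unit.app X)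
    (g := ⟨GCwfLoose.comparisonInv X.of, X.of.pseudo_comparisonInv⟩)
    (WideSub.Hom.isoMk X.of.comparisonUnit) (WideSub.Hom.isoMk X.of.comparisonCounit), rfl⟩

end WCC

theorem mainTheorem2 :
    ∃ β : WCC.Bireflection WCC.WCCmd.{v, u} WCC.GCwfLoose.{v, u},
      β.Lifts WCC.cmdAdj WCC.WCCmd.forgetCmd WCC.GCwfLoose.forgetAdj ∧
      β.IsOver WCC.WCCmd.forgetFib WCC.GCwfLoose.forgetFib ∧
      β.IsBiequivalence ∧
      (∃ β₁ : WCC.Bireflection WCC.WCCmd.{v, u} WCC.GCwf.{v, u},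
        β₁.Lifts β (CategoryTheory.StrictPseudofunctor.id _)
          (WCC.WideSub.incl WCC.GCwfLoose.left) ∧
        β₁.Lifts WCC.cmdAdjLeft WCC.WCCmd.forgetCmd WCC.GCwf.forgetAdj ∧
        β₁.Is2Reflection ∧
        (∃ β₂ : WCC.Bireflection WCC.WCCmdPs.{v, u} WCC.GCwfPs.{v, u},
          β₂.Lifts β₁ (WCC.WideSub.incl WCC.WCCmd.pseudo) WCC.GCwfPs.incl ∧
          β₂.Is2Reflection) ∧
        (∃ β₃ : WCC.Bireflection WCC.WCCmdStr.{v, u} WCC.GCwfStr.{v, u},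
          β₃.Lifts β₁ (WCC.WideSub.incl WCC.WCCmd.strict) WCC.GCwfStr.incl ∧
          β₃.Is2Reflection)) ∧
      (∃ β₄ : WCC.Bireflection WCC.WCCmdPs.{v, u} WCC.GCwfLoosePs.{v, u},
        β₄.Lifts β (WCC.WideSub.incl WCC.WCCmd.pseudo)
          (WCC.WideSub.incl WCC.GCwfLoose.pseudo) ∧
        β₄.IsBiequivalence) := by
  exact ⟨WCC.wcCmdGCwf, WCC.wcCmdGCwf_lifts, WCC.wcCmdGCwf_isOver, WCC.wcCmdGCwf_isBiequivalence,
    ⟨WCC.wcCmdGCwfLeft, WCC.wcCmdGCwfLeft_lifts, WCC.wcCmdGCwfLeft_lifts_cmdAdjLeft,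
      WCC.wcCmdGCwfLeft_is2Reflection,
      ⟨WCC.wcCmdGCwfPs, WCC.wcCmdGCwfPs_lifts, WCC.wcCmdGCwfPs_is2Reflection⟩,
      ⟨WCC.wcCmdGCwfStr, WCC.wcCmdGCwfStr_lifts, WCC.wcCmdGCwfStr_is2Reflection⟩⟩,
    ⟨WCC.wcCmdGCwfLoosePs, WCC.wcCmdGCwfLoosePs_lifts, WCC.wcCmdGCwfLoosePs_isBiequivalence⟩⟩
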